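/- Let $p\ge 1$ and $q$ be integers, $A_1,\dots,A_p>0$, $B_1,\dots,B_q>0$, and let $a_1,\dots,a_p$, $b_1,\dots,b_q$ be real. Put $$\rho=\prod_{k=1}^pA_k^{A_k}\prod_{j=1}^qB_j^{-B_j},\qquad \mu=\sum_{j=1}^q b_j-\sum_{k=1}^p a_k+\frac{p-q}{2},\qquad \gamma=-\min_{1\le k\le p}\frac{a_k}{A_k},$$ $$\nu=(2\pi)^{(p-q)/2}\prod_{k=1}^pA_k^{a_k-1/2}\prod_{j=1}^qB_j^{1/2-b_j}.$$ Let $\mathcal B_n$ be the $n$-th Bernoulli polynomial, given by $te^{at}/(e^t-1)=\sum_{n\ge0}\mathcal B_n(a)t^n/n!$, and define $l_0=1$ and, for $r\ge1$, $$l_r=\frac1r\sum_{n=1}^r q_n\,l_{r-n},\qquad q_n=\frac{(-1)^{n+1}}{n+1}\left[\sum_{k=1}^p\frac{\mathcal B_{n+1}(a_k)}{A_k^n}-\sum_{j=1}^q\frac{\mathcal B_{n+1}(b_j)}{B_j^n}\right].$$ For $x>0$, $x\ne\rho$, let Fox's function be $$H(x)=H^{p,0}_{q,p}\left(x\,\middle|\,{(\mathbf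 B,\mathbf b)\atop(\mathbf A,\mathbf a)}\right)=\frac1{2\pi i}\int_{\mathcal L}\frac{\prod_{k=1}^p\Gamma(A_kz+a_k)}{\prod_{j=1}^q\Gamma(B_jz+b_j)}\,x^{-z}\,dz .$$ Here $c>\gamma$ and $\varphi_1<0<\varphi_2$ are any fixed real numbers; for $x<\rho$ the contour $\mathcal L$ is the left loop that runs horizontally from $-\infty+i\varphi_1$ to $c+i\varphi_1$, vertically to $c+i\varphi_2$ and horizontally to $-\infty+i\varphi_2$, and for $x>\rho$ it is the right loop that runs horizontally from $+\infty+i\varphi_1$ to $c+i\varphi_1$, vertically to $c+i\varphi_2$ and horizontally to $+\infty+i\varphi_2$. (All poles of the integrand lie to the left of these loops.) **Theorem 2.** Suppose that $\sum_{j=1}^qB_j=\sum_{k=1}^pA_k$ and that $\mu=-m$ with $m\in\{0,1,2,\dots\}$. Then for every complex $s$ with $\Re s>\gamma$ the Mellin transform of $H$ exists, that is, $H(x)x^{s-1}$ is (absolutely) integrable on $(0,\infty)$, and $$\int_0^\infty H(x)x^{s-1}\,dx=\int_0^\rho H(x)x^{s-1}\,dx=\frac{\prod_{k=1}^p\Gamma(A_ks+a_k)}{\prod_{j=1}^q\Gamma(B_js+b_j)}-\nu\rho^s\sum_{k=0}^m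 l_{m-k}s^k .$$ -/

import Mathlib

/-!
Fox's function `H^{p,0}_{q,p}(x | (B,b); (A,a))` for positive `A`, `B` and real `a`, `b`,
with `∑ B = ∑ A`, and the constants attached to it.
-/

noncomputable section

namespace FoxH

variable {p q : ℕ}

/-- The gamma ratio `∏ₖ Γ(Aₖ s + aₖ) / ∏ⱼ Γ(Bⱼ s + bⱼ)`. Mathlib's `Γ` is `0` at its poles, so
the factor `1 / Γ(Bⱼ s + bⱼ)` is `0` there, as it should be. -/
def gammaRatio (A a : Fin p → ℝ) (B b : Fin q → ℝ) (s : ℂ) : ℂ :=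
  (∏ k, Complex.Gamma ((A k : ℂ) * s + (a k : ℂ))) /
    ∏ j, Complex.Gamma ((B j : ℂ) * s + (b j : ℂ))

/-- `Δ = ∑ⱼ Bⱼ - ∑ₖ Aₖ`. -/
def Delta (A : Fin p → ℝ) (B : Fin q → ℝ) : ℝ := ∑ j, B j - ∑ k, A k

/-- `μ = ∑ⱼ bⱼ - ∑ₖ aₖ + (p - q) / 2`. -/
def mu (a : Fin p → ℝ) (b : Fin q → ℝ) : ℝ :=
  ∑ j, b j - ∑ k, a k + ((p : ℝ) - (q : ℝ)) / 2

/-- `ρ = ∏ₖ Aₖ ^ Aₖ * ∏ⱼ Bⱼ ^ (-Bⱼ)`. -/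
def rho (A : Fin p → ℝ) (B : Fin q → ℝ) : ℝ :=
  (∏ k, A k ^ A k) * ∏ j, B j ^ (-B j)

/-- `ν = (2π) ^ ((p - q) / 2) * ∏ₖ Aₖ ^ (aₖ - 1/2) * ∏ⱼ Bⱼ ^ (1/2 - bⱼ)`. -/
def nu (A a : Fin p → ℝ) (B b : Fin q → ℝ) : ℝ :=
  (2 * Real.pi) ^ (((p : ℝ) - (q : ℝ)) / 2) *
    (∏ k, A k ^ (a k - 1 / 2)) * ∏ j, B j ^ (1 / 2 - b j)

/-- `γ = - minₖ (aₖ / Aₖ)`; for `p ≥ 1` the infimum of this finite family is its minimum. -/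
def gam (A a : Fin p → ℝ) : ℝ := -⨅ k, a k / A k

/-- The value at `x` of the `n`-th Bernoulli polynomial. -/
def bernoulliPoly (n : ℕ) (x : ℝ) : ℝ := Polynomial.aeval x (Polynomial.bernoulli n)

/-- `qₘ = (-1)^(m+1) / (m+1) * (∑ₖ ℬ_{m+1}(aₖ) / Aₖ^m - ∑ⱼ ℬ_{m+1}(bⱼ) / Bⱼ^m)`. -/
def qCoeff (A a : Fin p → ℝ) (B b : Fin q → ℝ) (m : ℕ) : ℝ :=
  (-1) ^ (m + 1) / ((m : ℝ) + 1) *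
    (∑ k, bernoulliPoly (m + 1) (a k) / A k ^ m - ∑ j, bernoulliPoly (m + 1) (b j) / B j ^ m)

/-- `l₀ = 1` and `l_r = (1/r) ∑_{m=1}^r qₘ l_{r-m}` for `r ≥ 1` (below, `m = i + 1` and the index
`r` of this formula is `r + 1`). -/
def lCoeff (A a : Fin p → ℝ) (B b : Fin q → ℝ) : ℕ → ℝ
  | 0 => 1
  | r + 1 => 1 / ((r : ℝ) + 1) *
      ∑ i : Fin (r + 1), qCoeff A a B b (i + 1) * lCoeff A a B b (r - i)
decreasing_by omega

/-- The integral of `F` over the left loop that runs from `-∞ + iφ₁` along a horizontal ray to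
`c + iφ₁`, then along a vertical segment to `c + iφ₂`, then along a horizontal ray to
`-∞ + iφ₂`. -/
def leftLoopIntegral (c φ₁ φ₂ : ℝ) (F : ℂ → ℂ) : ℂ :=
  (∫ t in Set.Iic c, F (t + φ₁ * Complex.I)) +
    Complex.I * (∫ t in φ₁..φ₂, F (c + t * Complex.I)) -
    ∫ t in Set.Iic c, F (t + φ₂ * Complex.I)

/-- The integral of `F` over the right loop that runs from `+∞ + iφ₁` along a horizontal ray to
`c + iφ₁`, then along a vertical segment to `c + iφ₂`, then along a horizontal ray to
`+∞ + iφ₂`. -/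
def rightLoopIntegral (c φ₁ φ₂ : ℝ) (F : ℂ → ℂ) : ℂ :=
  -(∫ t in Set.Ici c, F (t + φ₁ * Complex.I)) +
    Complex.I * (∫ t in φ₁..φ₂, F (c + t * Complex.I)) +
    ∫ t in Set.Ici c, F (t + φ₂ * Complex.I)

/-- Fox's function at `x > 0`: the Mellin-Barnes integral
`(1 / 2πi) ∫ ∏ₖ Γ(Aₖ s + aₖ) / ∏ⱼ Γ(Bⱼ s + bⱼ) x^{-s} ds` in the case `Δ = 0`, over a left loop
for `x < ρ` and over a right loop for `x > ρ`. All poles of the integrand are real and at most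
`γ`, so they lie to the left of both loops if `γ < c` and `φ₁ < 0 < φ₂`. The value at the single
point `x = ρ` plays no role. -/
def H (A a : Fin p → ℝ) (B b : Fin q → ℝ) (c φ₁ φ₂ : ℝ) (x : ℝ) : ℂ :=
  1 / (2 * Real.pi * Complex.I) *
    if x < rho A B then
      leftLoopIntegral c φ₁ φ₂ fun s => gammaRatio A a B b s * (x : ℂ) ^ (-s)
    else
      rightLoopIntegral c φ₁ φ₂ fun s => gammaRatio A a B b s * (x : ℂ) ^ (-s)

end FoxH

end

noncomputable section

namespace FoxH

open Filter Topology MeasureTheory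

variable {p q : ℕ}

/-! Write G for the gamma ratio. Since `∑ B = ∑ A` and `μ = -m`, Stirling's series gives `ρ^(-z)
G(z) = P(z) + K(z)`, where `P` is the polynomial `ν ∑ l_{m-k} z^k` and `K = O(1/|z|)` throughout
`|arg z| ≤ 3π/4`, not only in a half-plane (`exists_norm_gammaRatio_sub_le`). The integrand of `H`
is then `(K(z) + P(z)) exp(κ z)` with `κ = log(ρ/x)`.

If `x > ρ`, then `κ < 0`. The integrand is analytic between the two branches of the right loop and
decays exponentially to the right, so `H(x) = 0` (`H_eq_zero`).

If `x < ρ`, then `κ > 0`. The left loop is opened to a wedge formed by the two rays from `c'` in the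
directions `-1 ± 2i`, with `γ < c' < Re s` (`leftLoopIntegral_eq_wedge`). The term `P(z) exp(κ z)`
is entire and contributes nothing; only `K` survives, and it is small on and to the right of the
wedge. Opening the loop needs a polynomial bound for `ρ^(-z) G(z)` on the left, off the real axis.
The reflection formula turns `G(z)` into a quotient of sines, whose exponential growth cancels
because `∑ B = ∑ A`, times a gamma ratio of the same type at `-z`
(`exists_norm_gammaRatio_le_left`).

On the wedge, `∫₀^ρ (ρ/x)^z x^(s-1) dx = ρ^s / (s - z)`, because `Re z ≤ c' < Re s`. Fubini applies
because `K(z)/(s - z)` is `O(|z|^(-2))` along the rays (`mellin_ray`). Cauchy's formula for the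
wedge evaluates the remaining integral as `2πi K(s)` (`wedge_integral_eq`). The Mellin transform is
therefore `ρ^s K(s) = G(s) - ρ^s P(s)`.

Contour deformations are carried out with primitives: an analytic function on the plane slit along
`(-∞, γ]` has one (`exists_primitive_slit`), contour integrals become differences of its values, and
these are estimated along segments. -/

/-! ### The Stirling series of `Γ(z + a)` in a sector -/

/-- The coefficient of `z ^ (-(i + 1))` in the Stirling series of `log Γ(z + a)`. -/
def stirlingCoeff (a : ℝ) (i : ℕ) : ℝ :=
  (-1) ^ i * bernoulliPoly (i + 2) a / (((i : ℝ) + 1) * ((i : ℝ) + 2))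

lemma sum_choose_mul_bernoulliPoly (a : ℝ) (n : ℕ) :
    ∑ k ∈ Finset.range (n + 1), ((n + 1).choose k : ℝ) * bernoulliPoly k a = (n + 1) * a ^ n := by
  have h := congrArg (Polynomial.aeval a) (Polynomial.sum_bernoulli n)
  rw [map_sum] at h
  simp only [Polynomial.aeval_monomial, map_smul] at h
  have h2 : (algebraMap ℚ ℝ) ((n : ℚ) + 1) = (n : ℝ) + 1 := by simp
  rw [h2] at h
  rw [← h]
  refine Finset.sum_congr rfl fun k _ => ?_
  simp [bernoulliPoly, Algebra.smul_def]

lemma bernoulliPoly_zero (a : ℝ) : bernoulliPoly 0 a = 1 := by simp [bernoulliPoly]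

lemma bernoulliPoly_one (a : ℝ) : bernoulliPoly 1 a = a - 1 / 2 := by simp [bernoulliPoly]

/-- As `C(k,i)/((i+1)(i+2)) = C(k+2,i+2)/((k+1)(k+2))`, this is the Bernoulli recursion with the
terms of index 0 and 1 moved to the right. It makes the low Taylor coefficients of `stirlingDefect`
vanish. -/
lemma sum_choose_mul_stirlingCoeff (a : ℝ) (k : ℕ) :
    ∑ i ∈ Finset.range k, stirlingCoeff a i * ((-1) ^ (k + i) * (k.choose i : ℝ)) =
      (-1) ^ k * a ^ (k + 1) / (k + 1) - (-1) ^ (k + 1) / (k + 2) -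
        (a + 1 / 2) * ((-1) ^ k / (k + 1)) := by
  have h := sum_choose_mul_bernoulliPoly a (k + 1)
  rw [Finset.sum_range_succ', Finset.sum_range_succ', bernoulliPoly_zero, bernoulliPoly_one] at h
  have h1 : ∀ i ∈ Finset.range k, stirlingCoeff a i * ((-1) ^ (k + i) * (k.choose i : ℝ)) =
      (-1) ^ k / (((k : ℝ) + 1) * (k + 2)) *
        (((k + 1 + 1).choose (i + 1 + 1) : ℝ) * bernoulliPoly (i + 1 + 1) a) := by
    intro i _
    have e1 : ((k : ℝ) + 2) * ((k + 1).choose (i + 1)) = (k + 2).choose (i + 2) * (i + 2) := by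
      have := Nat.add_one_mul_choose_eq (k + 1) (i + 1)
      have h3 := congrArg (Nat.cast (R := ℝ)) this
      push_cast at h3
      linarith
    have e2 : ((k : ℝ) + 1) * (k.choose i) = (k + 1).choose (i + 1) * (i + 1) := by
      have := Nat.add_one_mul_choose_eq k i
      have h3 := congrArg (Nat.cast (R := ℝ)) this
      push_cast at h3
      linarith
    have e3 : ((-1 : ℝ) ^ i) * (-1) ^ (k + i) = (-1) ^ k := by
      rw [← pow_add, show i + (k + i) = k + 2 * i by ring, pow_add, pow_mul]
      simp
    have e4 : ((k + 2).choose (i + 2) : ℝ) * ((i + 2) * (i + 1)) =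
        ((k : ℝ) + 2) * ((k : ℝ) + 1) * (k.choose i) := by
      linear_combination (-(i : ℝ) - 1) * e1 - ((k : ℝ) + 2) * e2
    have hi1 : (i : ℝ) + 1 ≠ 0 := by positivity
    have hi2 : (i : ℝ) + 2 ≠ 0 := by positivity
    have hk1 : (k : ℝ) + 1 ≠ 0 := by positivity
    have hk2 : (k : ℝ) + 2 ≠ 0 := by positivity
    unfold stirlingCoeff
    rw [show k + 1 + 1 = k + 2 by rfl, show i + 1 + 1 = i + 2 by rfl]
    rw [div_mul_eq_mul_div, div_mul_eq_mul_div, div_eq_div_iff (by positivity) (by positivity)]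
    linear_combination (bernoulliPoly (i + 2) a * (k.choose i) * (k + 1) * (k + 2)) * e3
      - ((-1) ^ k * bernoulliPoly (i + 2) a) * e4
  rw [Finset.sum_congr rfl h1, ← Finset.mul_sum]
  have hk1 : (k : ℝ) + 1 ≠ 0 := by positivity
  have hk2 : (k : ℝ) + 2 ≠ 0 := by positivity
  have h2 : ∑ i ∈ Finset.range k,
        ((k + 1 + 1).choose (i + 1 + 1) : ℝ) * bernoulliPoly (i + 1 + 1) a =
      (k + 2) * a ^ (k + 1) - 1 - (k + 2) * (a - 1 / 2) := by
    simp only [Nat.choose_zero_right, zero_add, Nat.choose_one_right] at h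
    push_cast at h
    linear_combination h
  rw [h2, pow_succ (-1 : ℝ) k]
  field_simp
  ring

lemma hasSum_log_one_add_mul {a w : ℂ} (h : ‖a * w‖ < 1) :
    HasSum (fun k : ℕ => ((-1) ^ k * a ^ (k + 1) / (k + 1)) * w ^ (k + 1))
      (Complex.log (1 + a * w)) := by
  have := (hasSum_nat_add_iff' 1).2 (Complex.hasSum_taylorSeries_log h)
  simp only [Finset.range_one, Finset.sum_singleton, Nat.cast_zero, div_zero, sub_zero] at this
  convert! this using 2 with k
  push_cast
  rw [mul_pow, pow_add (-1 : ℂ) (k + 1) 1, pow_succ (-1 : ℂ) k]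
  ring

lemma hasSum_inv_mul_log_one_add {w : ℂ} (hw : w ≠ 0) (h : ‖w‖ < 1) :
    HasSum (fun k : ℕ => ((-1) ^ (k + 1) / ((k : ℂ) + 2)) * w ^ (k + 1))
      (w⁻¹ * Complex.log (1 + w) - 1) := by
  have h1 := (hasSum_log_one_add_mul (a := 1) (w := w) (by simpa using h)).mul_left w⁻¹
  have := (hasSum_nat_add_iff' 1).2 h1
  simp only [Finset.range_one, Finset.sum_singleton] at this
  convert! this using 2 with k
  · push_cast
    rw [pow_succ w (k + 1)]
    have : (k : ℂ) + 1 + 1 = k + 2 := by ring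
    rw [this]
    field_simp
    simp
  · simp
  · simp [hw]

/-- With `w = 1/z` one has `w/(1+w) = 1/(z+1)`, so this expands the correction terms at `z + 1`. The
index is shifted by `i`; the terms with `k < i` vanish with the binomial coefficient. -/
lemma hasSum_div_one_add_pow {w : ℂ} (h : ‖w‖ < 1) (i : ℕ) :
    HasSum (fun k : ℕ => ((-1) ^ (k + i) * (k.choose i : ℂ)) * w ^ (k + 1))
      ((w / (1 + w)) ^ (i + 1)) := by
  have h1 := (hasSum_choose_mul_geometric_of_norm_lt_one (𝕜 := ℂ) i (r := -w)
    (by simpa using h)).mul_left (w ^ (i + 1))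
  rw [sub_neg_eq_add, mul_one_div, ← div_pow] at h1
  refine (hasSum_nat_add_iff' i).1 ?_
  have h2 : ∑ k ∈ Finset.range i, ((-1 : ℂ) ^ (k + i) * (k.choose i : ℂ)) * w ^ (k + 1) = 0 := by
    refine Finset.sum_eq_zero fun k hk => ?_
    rw [Nat.choose_eq_zero_of_lt (Finset.mem_range.1 hk)]
    simp
  rw [h2, sub_zero]
  convert! h1 using 2 with k
  rw [neg_pow w k, show k + i + i = k + 2 * i by ring, pow_add (-1 : ℂ), pow_mul]
  simp only [even_two, Even.neg_pow, one_pow, mul_one]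
  ring

/-- The `k`-th coefficient of `stirlingDefect`. -/
def stirlingDefectCoeff (a : ℝ) (N k : ℕ) : ℝ :=
  (-1) ^ k * a ^ (k + 1) / (k + 1) - (-1) ^ (k + 1) / (k + 2) -
    (a + 1 / 2) * ((-1) ^ k / (k + 1)) -
    ∑ i ∈ Finset.range N, stirlingCoeff a i *
      ((-1) ^ (k + i) * (k.choose i : ℝ) - if k = i then 1 else 0)

/-- The indices `i < k` give the Bernoulli identity. For `i = k` the binomial term cancels against
the indicator, and for `i > k` both are zero. The case `k = N` is included because the identity
involves only `i < k`; hence the defect has order `N + 2`. -/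
lemma stirlingDefectCoeff_eq_zero (a : ℝ) {N k : ℕ} (hk : k ≤ N) :
    stirlingDefectCoeff a N k = 0 := by
  unfold stirlingDefectCoeff
  rw [← sum_choose_mul_stirlingCoeff, sub_eq_zero]
  rw [← Finset.sum_subset (Finset.range_subset_range.2 hk)]
  · refine Finset.sum_congr rfl fun i hi => ?_
    rw [if_neg (Finset.mem_range.1 hi).ne', sub_zero]
  · intro i _ hi
    rw [Finset.mem_range, not_lt] at hi
    rcases hi.eq_or_lt with rfl | h
    · rw [← two_mul, pow_mul]
      simp
    · simp [Nat.choose_eq_zero_of_lt h, h.ne]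

/-- The logarithm of `(z + a) f(z) / f(z + 1)`, as a function of `w = 1 / z`, where `f` is the
exponential of the Stirling series of `log Γ(z + a)` truncated after `N` terms. -/
def stirlingDefect (a : ℝ) (N : ℕ) (w : ℂ) : ℂ :=
  Complex.log (1 + a * w) - (w⁻¹ + a + 1 / 2) * Complex.log (1 + w) + 1 -
    ∑ i ∈ Finset.range N, (stirlingCoeff a i : ℂ) * ((w / (1 + w)) ^ (i + 1) - w ^ (i + 1))

lemma hasSum_stirlingDefect (a : ℝ) (N : ℕ) {w : ℂ} (hw : w ≠ 0) (h : ‖w‖ < 1)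
    (ha : ‖a * w‖ < 1) :
    HasSum (fun k : ℕ => (stirlingDefectCoeff a N k : ℂ) * w ^ (k + 1))
      (stirlingDefect a N w) := by
  have h1 := hasSum_log_one_add_mul ha
  have h2 := hasSum_inv_mul_log_one_add hw h
  have h3 := (hasSum_log_one_add_mul (a := 1) (w := w) (by simpa using h)).mul_left ((a : ℂ) + 1 / 2)
  have h4 : ∀ i ∈ Finset.range N, HasSum (fun k : ℕ => (stirlingCoeff a i : ℂ) *
      (((-1) ^ (k + i) * (k.choose i : ℂ)) * w ^ (k + 1) - if k = i then w ^ (i + 1) else 0))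
      ((stirlingCoeff a i : ℂ) * ((w / (1 + w)) ^ (i + 1) - w ^ (i + 1))) := by
    intro i _
    exact ((hasSum_div_one_add_pow h i).sub (hasSum_ite_eq i _)).mul_left _
  have h5 := hasSum_sum h4
  convert! ((h1.sub h2).sub h3).sub h5 using 1
  · ext k
    unfold stirlingDefectCoeff
    push_cast
    rw [sub_mul, sub_mul, sub_mul, Finset.sum_mul]
    congr 1
    · simp only [one_pow, mul_one]
      ring
    · refine Finset.sum_congr rfl fun i _ => ?_
      split_ifs with hki
      · subst hki; simp only [Complex.ofReal_one]; ring
      · simp only [Complex.ofReal_zero]; ring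
  · rw [stirlingDefect, one_mul]; ring

lemma norm_tsum_le_of_coeff_eq_zero {d : ℕ → ℂ} {N : ℕ} {r : ℝ} (hr : 0 < r)
    (hs : Summable fun k => d k * (r : ℂ) ^ (k + 1)) (hd : ∀ k ≤ N, d k = 0) :
    ∃ C, 0 ≤ C ∧ ∀ w : ℂ, ‖w‖ ≤ r / 2 → ∀ y, HasSum (fun k => d k * w ^ (k + 1)) y →
      ‖y‖ ≤ C * ‖w‖ ^ (N + 2) := by
  obtain ⟨M, hM⟩ := (hs.tendsto_atTop_zero.norm.bddAbove_range)
  have hM' : ∀ k, ‖d k‖ * r ^ (k + 1) ≤ M := by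
    intro k
    have := hM (Set.mem_range_self k)
    simpa [abs_of_pos hr] using this
  have hM0 : 0 ≤ M := le_trans (by positivity) (hM' 0)
  -- `M` bounds `|d k| r^(k+1)`, and 2 is the sum of a geometric series of ratio at most 1/2.
  refine ⟨2 * M / r ^ (N + 2), by positivity, fun w hw y hy => ?_⟩
  have hq : ‖w‖ / r ≤ 1 / 2 := by rw [div_le_div_iff₀ hr two_pos]; linarith
  have hq0 : 0 ≤ ‖w‖ / r := by positivity
  have hgeo : HasSum (fun k : ℕ => M * (‖w‖ / r) ^ (N + 2) * (‖w‖ / r) ^ k)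
      (M * (‖w‖ / r) ^ (N + 2) * (1 - ‖w‖ / r)⁻¹) :=
    (hasSum_geometric_of_lt_one hq0 (by linarith)).mul_left _
  have hy' : HasSum (fun k => d (k + (N + 1)) * w ^ (k + (N + 1) + 1)) y := by
    have := (hasSum_nat_add_iff' (N + 1)).2 hy
    rwa [Finset.sum_eq_zero, sub_zero] at this
    intro k hk
    rw [hd k (Nat.lt_succ_iff.1 (Finset.mem_range.1 hk)), zero_mul]
  have hb : ∀ k, ‖d (k + (N + 1)) * w ^ (k + (N + 1) + 1)‖ ≤
      M * (‖w‖ / r) ^ (N + 2) * (‖w‖ / r) ^ k := by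
    intro k
    rw [mul_assoc, ← pow_add, norm_mul, norm_pow, div_pow]
    have h := hM' (k + (N + 1))
    rw [show N + 2 + k = k + (N + 1) + 1 by ring, mul_div_assoc', le_div_iff₀ (by positivity)]
    calc _ = (‖d (k + (N + 1))‖ * r ^ (k + (N + 1) + 1)) * ‖w‖ ^ (k + (N + 1) + 1) := by ring
      _ ≤ _ := by gcongr
  have := tsum_of_norm_bounded hgeo hb
  rw [hy'.tsum_eq] at this
  refine this.trans ?_
  have h2 : (1 - ‖w‖ / r)⁻¹ ≤ 2 := by
    rw [inv_le_comm₀ (by linarith) two_pos]; linarith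
  calc _ ≤ M * (‖w‖ / r) ^ (N + 2) * 2 := by gcongr
    _ = _ := by rw [div_pow]; ring

lemma exists_norm_stirlingDefect_le (a : ℝ) (N : ℕ) :
    ∃ C δ : ℝ, 0 ≤ C ∧ 0 < δ ∧ δ ≤ 1 / 2 ∧ |a| * δ ≤ 1 / 2 ∧ ∀ w : ℂ, w ≠ 0 → ‖w‖ ≤ δ →
      ‖stirlingDefect a N w‖ ≤ C * ‖w‖ ^ (N + 2) := by
  -- Both `|w|` and `|a w|` are at most 1/2 in this disc, so both logarithms expand.
  set r : ℝ := 1 / (2 * (1 + |a|)) with hr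
  have hr0 : 0 < r := by positivity
  have hr1 : r ≤ 1 / 2 := by
    rw [hr]; gcongr; linarith [abs_nonneg a]
  have hr2 : |a| * r ≤ 1 / 2 := by
    rw [hr, mul_one_div, div_le_div_iff₀ (by positivity) two_pos]; linarith [abs_nonneg a]
  have hsum : ∀ w : ℂ, w ≠ 0 → ‖w‖ ≤ r → HasSum
      (fun k : ℕ => (stirlingDefectCoeff a N k : ℂ) * w ^ (k + 1)) (stirlingDefect a N w) := by
    intro w hw hwr
    refine hasSum_stirlingDefect a N hw (by linarith) ?_
    rw [norm_mul, Complex.norm_real, Real.norm_eq_abs]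
    calc |a| * ‖w‖ ≤ |a| * r := by gcongr
      _ < 1 := by linarith
  obtain ⟨C, hC0, hC⟩ := norm_tsum_le_of_coeff_eq_zero (N := N) hr0
    (hsum r (by exact_mod_cast hr0.ne') (by simp [abs_of_pos hr0])).summable
    (fun k hk => by rw [stirlingDefectCoeff_eq_zero a hk]; simp)
  refine ⟨C, r / 2, hC0, by positivity, by linarith, ?_, fun w hw hwr => ?_⟩
  · nlinarith [abs_nonneg a]
  · exact hC w hwr _ (hsum w hw (by linarith))

/-! ### Stirling's formula by telescoping in the sector -/

/-- The closed sector `|arg z| ≤ 3π/4`. -/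
def sector : Set ℂ := {z | -|z.im| ≤ z.re}

lemma sector_add {z : ℂ} (hz : z ∈ sector) {t : ℝ} (ht : 0 ≤ t) : z + t ∈ sector := by
  simp only [sector, Set.mem_ofPred_eq, Complex.add_im, Complex.ofReal_im, add_zero,
    Complex.add_re, Complex.ofReal_re] at *
  linarith

lemma sector_mul {z : ℂ} (hz : z ∈ sector) {t : ℝ} (ht : 0 ≤ t) : (t : ℂ) * z ∈ sector := by
  simp only [sector, Set.mem_ofPred_eq, Complex.re_ofReal_mul, Complex.im_ofReal_mul, abs_mul,
    abs_of_nonneg ht] at *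
  nlinarith

/-- The angle between `z` and the positive axis is at most `3π/4`, so `z` and `t` cannot cancel
much. This keeps all translates `z + i` large and makes their defects summable uniformly. -/
lemma norm_add_ge_of_mem_sector {z : ℂ} (hz : z ∈ sector) {t : ℝ} (ht : 0 ≤ t) :
    (‖z‖ + t) / 4 ≤ ‖z + t‖ := by
  have h1 : ‖z‖ ^ 2 = z.re ^ 2 + z.im ^ 2 := by
    rw [Complex.sq_norm, Complex.normSq_apply]; ring
  have h2 : ‖z + t‖ ^ 2 = (z.re + t) ^ 2 + z.im ^ 2 := by
    rw [Complex.sq_norm, Complex.normSq_apply]; simp; ring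
  have hz' : -|z.im| ≤ z.re := hz
  refine abs_le_of_sq_le_sq' ?_ (norm_nonneg _) |>.2
  rw [h2]
  have h3 : ((‖z‖ + t) / 4) ^ 2 ≤ (‖z‖ ^ 2 + t ^ 2) / 8 := by nlinarith [sq_nonneg (‖z‖ - t)]
  refine h3.trans ?_
  rw [h1]
  rcases le_or_gt 0 z.re with h | h
  · nlinarith [mul_nonneg h ht, sq_nonneg z.re, sq_nonneg z.im, sq_nonneg t]
  · have h4 : z.re ^ 2 ≤ z.im ^ 2 := by
      rw [← sq_abs z.im]
      nlinarith [abs_nonneg z.im]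
    nlinarith [sq_nonneg (t + 2 * z.re)]

/-- Translation by 1 keeps the imaginary part, and a real point of the sector is nonnegative; the
cut of the logarithm is never crossed. -/
lemma log_add_one_sub_log {z : ℂ} (hz : z ∈ sector) (h0 : z ≠ 0) (h1 : z + 1 ≠ 0) :
    Complex.log (z + 1) - Complex.log z = Complex.log (1 + z⁻¹) := by
  have he : Complex.exp (Complex.log (z + 1) - Complex.log z) = 1 + z⁻¹ := by
    rw [Complex.exp_sub, Complex.exp_log h1, Complex.exp_log h0]
    field_simp
  rw [← he, Complex.log_exp]
  all_goals rw [Complex.sub_im, Complex.log_im, Complex.log_im]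
  all_goals
    have a1 := Complex.arg_le_pi z
    have a2 := Complex.neg_pi_lt_arg z
    have a3 := Complex.arg_le_pi (z + 1)
    have a4 := Complex.neg_pi_lt_arg (z + 1)
    rcases lt_trichotomy z.im 0 with h | h | h
    · have := Complex.arg_neg_iff.2 h
      have := Complex.arg_neg_iff.2 (show (z + 1).im < 0 by simpa using h)
      linarith
    · have hr : 0 ≤ z.re := by simpa [sector, h] using hz
      have := Complex.arg_eq_zero_iff.2 ⟨hr, h⟩
      have := Complex.arg_eq_zero_iff (z := z + 1).2 ⟨by simp; linarith, by simpa using h⟩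
      linarith [Real.pi_pos]
    · have := Complex.arg_nonneg_iff.2 h.le
      have := Complex.arg_nonneg_iff.2 (show 0 ≤ (z + 1).im by simpa using h.le)
      have : Complex.arg z ≠ Real.pi := by
        rw [Ne, Complex.arg_eq_pi_iff]
        exact fun h' => h.ne' h'.2
      have := lt_of_le_of_ne a1 this
      linarith

/-- The Stirling series of `log Γ(z + a)`, truncated after `N` terms. -/
def stirlingLog (a : ℝ) (N : ℕ) (z : ℂ) : ℂ :=
  (z + a - 1 / 2) * Complex.log z - z + (Real.log (2 * Real.pi) / 2 : ℝ) +
    ∑ i ∈ Finset.range N, (stirlingCoeff a i : ℂ) * z⁻¹ ^ (i + 1)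

/-- The Stirling approximation satisfies the recursion of `Γ(z + a)` up to the factor `exp
(stirlingDefect)`. In exponential form no branch of `log (z + a)` has to be chosen. -/
lemma exp_stirlingLog_add_one (a : ℝ) (N : ℕ) {z : ℂ} (hz : z ∈ sector) (h0 : z ≠ 0)
    (h1 : z + 1 ≠ 0) (ha : z + a ≠ 0) :
    Complex.exp (stirlingLog a N (z + 1)) * Complex.exp (stirlingDefect a N z⁻¹) =
      Complex.exp (stirlingLog a N z) * (z + a) := by
  have hza : z + a = z * (1 + a * z⁻¹) := by field_simp
  have hne : 1 + a * z⁻¹ ≠ 0 := fun h => ha (by rw [hza, h, mul_zero])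
  have hlog : Complex.exp (Complex.log z + Complex.log (1 + a * z⁻¹)) = z + a := by
    rw [Complex.exp_add, Complex.exp_log h0, Complex.exp_log hne, hza]
  rw [← hlog, ← Complex.exp_add, ← Complex.exp_add]
  congr 1
  have hw : z⁻¹ / (1 + z⁻¹) = (z + 1)⁻¹ := by
    field_simp
  unfold stirlingLog stirlingDefect
  rw [hw, inv_inv, ← log_add_one_sub_log hz h0 h1]
  simp only [mul_sub, Finset.sum_sub_distrib]
  ring

lemma Gamma_add_natCast_add_one (s : ℂ) (hs : ∀ n : ℕ, s + n ≠ 0) (n : ℕ) :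
    Complex.Gamma (s + n + 1) =
      (∏ j ∈ Finset.range (n + 1), (s + j)) * Complex.Gamma s := by
  induction n with
  | zero => simpa using Complex.Gamma_add_one s (by simpa using hs 0)
  | succ n ih =>
    rw [Complex.Gamma_add_one _ (hs _), Finset.prod_range_succ]
    push_cast
    rw [← add_assoc, ih]
    ring

/-- Euler's limit for `Γ(z + a)` combined with Stirling's formula for `n!`; this is what fixes the
constant `log(2π)/2`. The shift is `n + 1` because `GammaSeq` has `n + 1` factors in its
denominator. -/
lemma tendsto_Gamma_div_exp_stirlingLog (a : ℝ) (N : ℕ) {z : ℂ}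
    (hz : ∀ n : ℕ, z + n ≠ 0) (hs : ∀ n : ℕ, z + n + a ≠ 0) :
    Tendsto (fun n : ℕ => Complex.Gamma (z + (n + 1 : ℕ) + a) /
      Complex.exp (stirlingLog a N (z + (n + 1 : ℕ)))) atTop (𝓝 1) := by
  have hs' : ∀ n : ℕ, z + a + n ≠ 0 := fun n => by
    have := hs n
    rwa [add_right_comm] at this
  have hG : Complex.Gamma (z + a) ≠ 0 := Complex.Gamma_ne_zero fun n h => hs' n (by rw [h]; ring)
  have l1 : Tendsto (fun n : ℕ => Complex.Gamma (z + a) / Complex.GammaSeq (z + a) n) atTop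
      (𝓝 1) := by
    have := (tendsto_const_nhds (x := Complex.Gamma (z + a))).div
      (Complex.GammaSeq_tendsto_Gamma (z + a)) hG
    rwa [div_self hG] at this
  have hinv : Tendsto (fun n : ℕ => (z + (n + 1 : ℕ))⁻¹) atTop (𝓝 0) := by
    refine tendsto_inv₀_cobounded.comp ?_
    rw [← tendsto_norm_atTop_iff_cobounded]
    refine tendsto_atTop_mono (f := fun n : ℕ => (n : ℝ) + (1 - ‖z‖)) (fun n => ?_)
      (tendsto_atTop_add_const_right _ _ tendsto_natCast_atTop_atTop)
    have h := norm_sub_le (z + (n + 1 : ℕ)) z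
    rw [add_sub_cancel_left, Complex.norm_natCast] at h
    push_cast at h ⊢
    linarith
  have hlog : Tendsto (fun n : ℕ => (n : ℂ) * Complex.log (1 + (z + 1) / n)) atTop
      (𝓝 (z + 1)) := by
    refine Complex.tendsto_nat_mul_log_one_add_of_tendsto ?_
    refine tendsto_const_nhds.congr' ?_
    filter_upwards [eventually_ne_atTop 0] with n hn
    have : (n : ℂ) ≠ 0 := by exact_mod_cast hn
    field_simp
  have hlog0 : Tendsto (fun n : ℕ => Complex.log (1 + (z + 1) / n)) atTop (𝓝 0) := by
    have h := (tendsto_inv_atTop_nhds_zero_nat (𝕜 := ℂ)).mul hlog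
    rw [zero_mul] at h
    refine h.congr' ?_
    filter_upwards [eventually_ne_atTop 0] with n hn
    have : (n : ℂ) ≠ 0 := by exact_mod_cast hn
    field_simp
  have hpow : Tendsto (fun n : ℕ => ∑ i ∈ Finset.range N,
      (stirlingCoeff a i : ℂ) * (z + (n + 1 : ℕ))⁻¹ ^ (i + 1)) atTop (𝓝 0) := by
    have : Tendsto (fun n : ℕ => ∑ i ∈ Finset.range N,
      (stirlingCoeff a i : ℂ) * (z + (n + 1 : ℕ))⁻¹ ^ (i + 1)) atTop
      (𝓝 (∑ i ∈ Finset.range N, (stirlingCoeff a i : ℂ) * 0 ^ (i + 1))) :=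
      tendsto_finsetSum _ fun i _ => (hinv.pow (i + 1)).const_mul _
    simpa using this
  -- The exponent left after the powers of `n` cancel; its last term compensates the limit `√π` of
  -- `stirlingSeq`.
  have hex : Tendsto (fun n : ℕ => -(n * Complex.log (1 + (z + 1) / n)) -
      (z + a + 1 / 2) * Complex.log (1 + (z + 1) / n) + (z + 1) -
      ∑ i ∈ Finset.range N, (stirlingCoeff a i : ℂ) * (z + (n + 1 : ℕ))⁻¹ ^ (i + 1) -
      (Real.log Real.pi / 2 : ℝ)) atTop (𝓝 (-(z + 1) - (z + a + 1 / 2) * 0 + (z + 1) - 0 -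
        (Real.log Real.pi / 2 : ℝ))) :=
    (((hlog.neg.sub (hlog0.const_mul _)).add_const _).sub hpow).sub_const _
  have hst : Tendsto (fun n : ℕ => ((Stirling.stirlingSeq n : ℝ) : ℂ)) atTop
      (𝓝 ((√Real.pi : ℝ) : ℂ)) :=
    (Complex.continuous_ofReal.tendsto _).comp Stirling.tendsto_stirlingSeq_sqrt_pi
  have l2 := hst.mul ((Complex.continuous_exp.tendsto _).comp hex)
  have hone : ((√Real.pi : ℝ) : ℂ) * Complex.exp (-(z + 1) - (z + a + 1 / 2) * 0 + (z + 1) - 0 -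
        (Real.log Real.pi / 2 : ℝ)) = 1 := by
    have e : √Real.pi = Real.exp (Real.log Real.pi / 2) := by
      rw [Real.sqrt_eq_rpow, Real.rpow_def_of_pos Real.pi_pos]; ring_nf
    rw [e, Complex.ofReal_exp, ← Complex.exp_add]
    rw [Complex.exp_eq_one_iff]
    exact ⟨0, by simp⟩
  rw [hone] at l2
  have l3 := l1.mul l2
  rw [one_mul] at l3
  refine l3.congr' ?_
  filter_upwards [eventually_ge_atTop 1] with n hn
  have hnR : (0 : ℝ) < n := by exact_mod_cast hn
  have hn0 : (n : ℂ) ≠ 0 := by exact_mod_cast hnR.ne'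
  have hzn : z + (n + 1 : ℕ) = ((n : ℝ) : ℂ) * (1 + (z + 1) / n) := by
    push_cast; field_simp; ring
  have hne : 1 + (z + 1) / n ≠ 0 := fun h => hz (n + 1) (by rw [hzn, h, mul_zero])
  have hlogz : Complex.log (z + (n + 1 : ℕ)) = Real.log n + Complex.log (1 + (z + 1) / n) := by
    rw [hzn, Complex.log_ofReal_mul hnR hne]
  have hprod : ∏ j ∈ Finset.range (n + 1), (z + a + j) ≠ 0 :=
    Finset.prod_ne_zero_iff.2 fun j _ => hs' j
  have hGn : Complex.Gamma (z + (n + 1 : ℕ) + a) =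
      (∏ j ∈ Finset.range (n + 1), (z + a + j)) * Complex.Gamma (z + a) := by
    rw [← Gamma_add_natCast_add_one _ hs']
    push_cast; ring_nf
  have hfac : ((n.factorial : ℝ) : ℂ) = (Stirling.stirlingSeq n : ℝ) *
      Complex.exp ((Real.log 2 / 2 + Real.log n / 2 + n * Real.log n - n : ℝ)) := by
    rw [← Complex.ofReal_exp, ← Complex.ofReal_mul]
    congr 1
    have e1 : Real.exp (Real.log 2 / 2 + Real.log n / 2 + n * Real.log n - n) =
        √(2 * n) * (n / Real.exp 1) ^ n := by
      rw [Real.sqrt_eq_rpow, Real.rpow_def_of_pos (by positivity), Real.log_mul two_ne_zero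
        hnR.ne']
      have : (n : ℝ) / Real.exp 1 = Real.exp (Real.log n - 1) := by
        rw [Real.exp_sub, Real.exp_log hnR]
      rw [this, ← Real.exp_nat_mul, ← Real.exp_add]
      ring_nf
    rw [e1, Stirling.stirlingSeq, div_mul_cancel₀]
    positivity
  have hfac' : (n.factorial : ℂ) = (Stirling.stirlingSeq n : ℝ) *
      Complex.exp ((Real.log 2 / 2 + Real.log n / 2 + n * Real.log n - n : ℝ)) := by
    rw [← hfac]; simp
  have hns : (n : ℂ) ^ (z + a) = Complex.exp (Real.log n * (z + a)) := by
    rw [Complex.cpow_def_of_ne_zero hn0, Complex.natCast_log]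
  have hst0 : ((Stirling.stirlingSeq n : ℝ) : ℂ) ≠ 0 := by
    intro h
    rw [h, zero_mul] at hfac'
    exact Nat.cast_ne_zero.2 n.factorial_ne_zero hfac'
  rw [hGn, Complex.GammaSeq, hns, hfac', Function.comp_apply, stirlingLog, hlogz]
  rw [div_div_eq_mul_div, eq_div_iff (Complex.exp_ne_zero _), div_mul_eq_mul_div,
    div_mul_eq_mul_div, div_eq_iff (by
      exact mul_ne_zero (Complex.exp_ne_zero _) (mul_ne_zero hst0 (Complex.exp_ne_zero _)))]
  have key : Complex.exp (-(n * Complex.log (1 + (z + 1) / n)) -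
      (z + a + 1 / 2) * Complex.log (1 + (z + 1) / n) + (z + 1) -
      ∑ i ∈ Finset.range N, (stirlingCoeff a i : ℂ) * (z + (n + 1 : ℕ))⁻¹ ^ (i + 1) -
      (Real.log Real.pi / 2 : ℝ)) * Complex.exp ((z + (n + 1 : ℕ) + a - 1 / 2) *
        (Real.log n + Complex.log (1 + (z + 1) / n)) - (z + (n + 1 : ℕ)) +
        (Real.log (2 * Real.pi) / 2 : ℝ) +
        ∑ i ∈ Finset.range N, (stirlingCoeff a i : ℂ) * (z + (n + 1 : ℕ))⁻¹ ^ (i + 1)) =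
      Complex.exp (Real.log n * (z + a)) *
        Complex.exp ((Real.log 2 / 2 + Real.log n / 2 + n * Real.log n - n : ℝ)) := by
    rw [← Complex.exp_add, ← Complex.exp_add, Real.log_mul two_ne_zero Real.pi_ne_zero]
    congr 1
    push_cast
    ring
  linear_combination (Complex.Gamma (z + a) * (∏ j ∈ Finset.range (n + 1), (z + a + j)) *
    ((Stirling.stirlingSeq n : ℝ) : ℂ)) * key

lemma sum_range_inv_sq_le {x : ℝ} (hx : 2 ≤ x) (n : ℕ) :
    ∑ i ∈ Finset.range n, 1 / (x + i) ^ 2 ≤ 2 / x := by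
  have h : ∑ i ∈ Finset.range n, 1 / (x + i) ^ 2 ≤ 1 / (x - 1) - 1 / (x + n - 1) := by
    induction n with
    | zero => simp
    | succ n ih =>
      rw [Finset.sum_range_succ]
      have hn : (0 : ℝ) ≤ n := Nat.cast_nonneg n
      have h1 : 0 < x + n - 1 := by linarith
      have h2 : 0 < x + n := by linarith
      have h3 : 1 / (x + n) ^ 2 ≤ 1 / (x + n - 1) - 1 / (x + (n + 1 : ℕ) - 1) := by
        push_cast
        rw [show x + ((n : ℝ) + 1) - 1 = x + n by ring, div_sub_div _ _ h1.ne' h2.ne']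
        rw [div_le_div_iff₀ (by positivity) (by positivity)]
        nlinarith
      linarith
  have hn : (0 : ℝ) ≤ n := Nat.cast_nonneg n
  have h1 : 0 ≤ 1 / (x + n - 1) := one_div_nonneg.2 (by linarith)
  have h2 : 1 / (x - 1) ≤ 2 / x := by
    rw [div_le_div_iff₀ (by linarith) (by linarith)]; linarith
  linarith

/-- **Stirling's formula** for `Γ(z + a)` with `N` correction terms, in the sector
`|arg z| ≤ 3π/4`. -/
theorem exists_Gamma_eq_exp_stirlingLog (a : ℝ) (N : ℕ) :
    ∃ C R : ℝ, 0 ≤ C ∧ 0 < R ∧ ∀ z ∈ sector, R ≤ ‖z‖ → ∃ e : ℂ, ‖e‖ ≤ C / ‖z‖ ^ (N + 1) ∧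
      Complex.Gamma (z + a) = Complex.exp (stirlingLog a N z + e) := by
  obtain ⟨C, δ, hC, hδ, hδ1, haδ, hbd⟩ := exists_norm_stirlingDefect_le a N
  -- The power of 4 comes from `norm_add_ge_of_mem_sector`, the factor 2 from `sum_range_inv_sq_le`.
  -- The radius `4 / δ` gives `|z + i| ≥ 1/δ` for all `i`, so the defect bound applies at every
  -- translate.
  refine ⟨C * 4 ^ (N + 2) * 2, 4 / δ, by positivity, by positivity, fun z hz hzR => ?_⟩
  have hz8 : 8 ≤ ‖z‖ := by
    refine le_trans ?_ hzR
    rw [le_div_iff₀ hδ]; linarith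
  have hpos : 0 < ‖z‖ := by linarith
  have hsec : ∀ i : ℕ, z + i ∈ sector := fun i => by
    have := sector_add hz (Nat.cast_nonneg (α := ℝ) i)
    simpa using this
  have hnorm : ∀ i : ℕ, (‖z‖ + i) / 4 ≤ ‖z + i‖ := fun i => by
    have := norm_add_ge_of_mem_sector hz (Nat.cast_nonneg (α := ℝ) i)
    simpa using this
  have hlarge : ∀ i : ℕ, 1 / δ ≤ ‖z + i‖ := fun i => by
    refine le_trans ?_ (hnorm i)
    have hi : (0 : ℝ) ≤ i := Nat.cast_nonneg i
    rw [show 1 / δ = (4 / δ) / 4 by ring]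
    linarith
  have hne : ∀ i : ℕ, z + i ≠ 0 := fun i => by
    rw [← norm_pos_iff]
    exact lt_of_lt_of_le (by positivity) (hlarge i)
  have hnea : ∀ i : ℕ, z + i + a ≠ 0 := fun i h => by
    have h1 : z + i = -(a : ℂ) := eq_neg_of_add_eq_zero_left h
    have h2 := hlarge i
    rw [h1, norm_neg, Complex.norm_real, Real.norm_eq_abs, div_le_iff₀ hδ] at h2
    linarith
  have hd : ∀ i : ℕ, ‖stirlingDefect a N (z + i)⁻¹‖ ≤
      C * 4 ^ (N + 2) / ‖z‖ ^ N * (1 / (‖z‖ + i) ^ 2) := by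
    intro i
    have hi : (0 : ℝ) ≤ i := Nat.cast_nonneg i
    have h1 := hbd (z + i)⁻¹ (inv_ne_zero (hne i)) (by
      rw [norm_inv, inv_le_comm₀ (norm_pos_iff.2 (hne i)) hδ, ← one_div]
      exact hlarge i)
    refine h1.trans ?_
    have h2 : ‖(z + i)⁻¹‖ ≤ 4 / (‖z‖ + i) := by
      rw [norm_inv, inv_le_comm₀ (norm_pos_iff.2 (hne i)) (by positivity), inv_div]
      exact hnorm i
    calc C * ‖(z + i)⁻¹‖ ^ (N + 2) ≤ C * (4 / (‖z‖ + i)) ^ (N + 2) := by gcongr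
      _ = C * 4 ^ (N + 2) * (1 / ((‖z‖ + i) ^ N * (‖z‖ + i) ^ 2)) := by
        rw [div_pow, pow_add (‖z‖ + i)]; ring
      _ ≤ C * 4 ^ (N + 2) * (1 / (‖z‖ ^ N * (‖z‖ + i) ^ 2)) := by
        gcongr
        linarith
      _ = _ := by field_simp
  have hsums : ∀ n : ℕ, ∑ i ∈ Finset.range n, ‖stirlingDefect a N (z + i)⁻¹‖ ≤
      C * 4 ^ (N + 2) * 2 / ‖z‖ ^ (N + 1) := by
    intro n
    calc _ ≤ ∑ i ∈ Finset.range n, C * 4 ^ (N + 2) / ‖z‖ ^ N * (1 / (‖z‖ + i) ^ 2) :=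
          Finset.sum_le_sum fun i _ => hd i
      _ ≤ C * 4 ^ (N + 2) / ‖z‖ ^ N * (2 / ‖z‖) := by
          rw [← Finset.mul_sum]
          gcongr
          exact sum_range_inv_sq_le (by linarith) n
      _ = _ := by rw [pow_succ ‖z‖ N]; field_simp
  have hsummable : Summable fun i : ℕ => ‖stirlingDefect a N (z + i)⁻¹‖ :=
    summable_of_sum_range_le (fun _ => norm_nonneg _) hsums
  -- Telescoping: each step from `z + i` to `z + i + 1` multiplies the quotient of Γ by its
  -- approximation by one exponential defect. The quotient tends to 1, which determines its value at
  -- `z`.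
  have hrec : ∀ n : ℕ, Complex.Gamma (z + n + a) / Complex.exp (stirlingLog a N (z + n)) =
      Complex.Gamma (z + a) / Complex.exp (stirlingLog a N z) *
        Complex.exp (∑ i ∈ Finset.range n, stirlingDefect a N (z + i)⁻¹) := by
    intro n
    induction n with
    | zero => simp
    | succ n ih =>
      have h1 := exp_stirlingLog_add_one a N (hsec n) (hne n) (by
        have := hne (n + 1); push_cast at this; rwa [← add_assoc] at this) (hnea n)
      rw [Finset.sum_range_succ, Complex.exp_add, ← mul_assoc, ← ih]
      push_cast
      rw [← add_assoc, show z + n + 1 + a = z + n + a + 1 by ring,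
        Complex.Gamma_add_one _ (hnea n), div_mul_eq_mul_div,
        div_eq_div_iff (Complex.exp_ne_zero _) (Complex.exp_ne_zero _)]
      linear_combination (-Complex.Gamma (z + n + a)) * h1
  have hlim := tendsto_Gamma_div_exp_stirlingLog a N hne hnea
  simp_rw [hrec] at hlim
  have hlim2 : Tendsto (fun n : ℕ => Complex.Gamma (z + a) / Complex.exp (stirlingLog a N z) *
        Complex.exp (∑ i ∈ Finset.range (n + 1), stirlingDefect a N (z + i)⁻¹)) atTop
      (𝓝 (Complex.Gamma (z + a) / Complex.exp (stirlingLog a N z) *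
        Complex.exp (∑' i : ℕ, stirlingDefect a N (z + i)⁻¹))) := by
    refine Tendsto.const_mul _ ((Complex.continuous_exp.tendsto _).comp ?_)
    exact hsummable.of_norm.hasSum.tendsto_sum_nat.comp (tendsto_add_atTop_nat 1)
  have heq := tendsto_nhds_unique hlim hlim2
  refine ⟨-∑' i : ℕ, stirlingDefect a N (z + i)⁻¹, ?_, ?_⟩
  · rw [norm_neg]
    exact (norm_tsum_le_tsum_norm hsummable).trans
      (hsummable.tsum_le_of_sum_range_le hsums)
  · rw [Complex.exp_add, Complex.exp_neg]
    have h1 := Complex.exp_ne_zero (stirlingLog a N z)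
    have h2 := Complex.exp_ne_zero (∑' i : ℕ, stirlingDefect a N (z + i)⁻¹)
    rw [div_mul_eq_mul_div, eq_div_iff h1, one_mul] at heq
    rw [heq]
    field_simp

/-! ### The asymptotic expansion of the gamma ratio -/

lemma norm_eval_le_of_X_pow_dvd {P : Polynomial ℂ} {N : ℕ} (h : Polynomial.X ^ N ∣ P) :
    ∃ C, 0 ≤ C ∧ ∀ w : ℂ, ‖w‖ ≤ 1 → ‖P.eval w‖ ≤ C * ‖w‖ ^ N := by
  obtain ⟨P₂, rfl⟩ := h
  obtain ⟨C, hC⟩ := (isCompact_closedBall (0 : ℂ) 1).exists_bound_of_continuousOn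
    P₂.continuous.continuousOn
  refine ⟨C, (norm_nonneg _).trans (hC 0 (by simp)), fun w hw => ?_⟩
  rw [Polynomial.eval_mul, norm_mul, mul_comm, Polynomial.eval_pow, Polynomial.eval_X, norm_pow]
  gcongr
  exact hC w (by simpa using hw)

/-- If `(r + 1) l_{r+1} = ∑ qᵢ l_{r-i}`, then `∑ lᵣ wʳ` is the Taylor expansion of
`exp (∑ qᵢ w^(i+1) / (i+1))`. -/
lemma exists_norm_exp_sub_sum_le (N : ℕ) (q l : ℕ → ℂ) (h0 : l 0 = 1)
    (hl : ∀ r : ℕ, ((r : ℂ) + 1) * l (r + 1) = ∑ i ∈ Finset.range (r + 1), q i * l (r - i)) :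
    ∃ C D, 0 ≤ C ∧ 0 ≤ D ∧ ∀ w : ℂ, ‖w‖ ≤ 1 →
      ‖Complex.exp (∑ i ∈ Finset.range N, q i / (i + 1) * w ^ (i + 1))‖ ≤ D ∧
      ‖Complex.exp (∑ i ∈ Finset.range N, q i / (i + 1) * w ^ (i + 1)) -
        ∑ r ∈ Finset.range (N + 1), l r * w ^ r‖ ≤ C * ‖w‖ ^ (N + 1) := by
  set Q : Polynomial ℂ := ∑ i ∈ Finset.range N, Polynomial.monomial (i + 1) (q i / (i + 1)) with hQ
  set T : Polynomial ℂ := ∑ r ∈ Finset.range (N + 1), Polynomial.monomial r (l r) with hT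
  have hQe : ∀ w, ∑ i ∈ Finset.range N, q i / (i + 1) * w ^ (i + 1) = Q.eval w := by
    intro w; simp [hQ, Polynomial.eval_finsetSum]
  have hTe : ∀ w, ∑ r ∈ Finset.range (N + 1), l r * w ^ r = T.eval w := by
    intro w; simp [hT, Polynomial.eval_finsetSum]
  have hTc : ∀ r ≤ N, T.coeff r = l r := by
    intro r hr
    simp [hT, Polynomial.coeff_monomial, Nat.lt_succ_iff.2 hr]
  have hQc : ∀ i < N, Q.derivative.coeff i = q i := by
    intro i hi
    have : (i : ℂ) + 1 ≠ 0 := by exact_mod_cast Nat.succ_ne_zero i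
    rw [Polynomial.coeff_derivative, hQ, Polynomial.finsetSum_coeff]
    simp only [Polynomial.coeff_monomial, add_left_inj]
    rw [Finset.sum_ite_eq' (Finset.range N) i, if_pos (Finset.mem_range.2 hi)]
    field_simp
  -- The recursion for `l` is the coefficient form of `T' = Q' T` below degree `N`.
  have hdvd : Polynomial.X ^ N ∣ T.derivative - Q.derivative * T := by
    rw [Polynomial.X_pow_dvd_iff]
    intro k hk
    rw [Polynomial.coeff_sub, Polynomial.coeff_derivative, hTc (k + 1) hk, Polynomial.coeff_mul,
      Finset.Nat.sum_antidiagonal_eq_sum_range_succ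
        (fun i j => Q.derivative.coeff i * T.coeff j), mul_comm, hl, sub_eq_zero]
    refine Finset.sum_congr rfl fun i hi => ?_
    have := Finset.mem_range.1 hi
    rw [hQc i (by omega), hTc _ (by omega)]
  obtain ⟨C₁, hC₁0, hC₁⟩ := norm_eval_le_of_X_pow_dvd hdvd
  obtain ⟨D, hD⟩ := (isCompact_closedBall (0 : ℂ) 1).exists_bound_of_continuousOn
    (f := fun w => Complex.exp (Q.eval w)) (by fun_prop)
  obtain ⟨D', hD'⟩ := (isCompact_closedBall (0 : ℂ) 1).exists_bound_of_continuousOn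
    (f := fun w => Complex.exp (-Q.eval w)) (by fun_prop)
  have hD0 : 0 ≤ D := (norm_nonneg _).trans (hD 0 (by simp))
  have hD'0 : 0 ≤ D' := (norm_nonneg _).trans (hD' 0 (by simp))
  refine ⟨D * (C₁ * D'), D, by positivity, hD0, fun w hw => ?_⟩
  rw [hQe, hTe]
  refine ⟨hD w (by simpa using hw), ?_⟩
  -- The derivative of `T exp(-Q)` is `O(|w|^N)` and its value at 0 is 1; the mean value inequality
  -- gains one more power of `w`.
  have hderiv : ∀ x : ℂ, HasDerivAt (fun x => T.eval x * Complex.exp (-Q.eval x))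
      ((T.derivative - Q.derivative * T).eval x * Complex.exp (-Q.eval x)) x := by
    intro x
    have := (T.hasDerivAt x).mul ((Q.hasDerivAt x).neg.cexp)
    convert! this using 1
    rw [Polynomial.eval_sub, Polynomial.eval_mul]
    simp only [Pi.neg_apply]
    ring
  have hmv := (convex_closedBall (0 : ℂ) ‖w‖).norm_image_sub_le_of_norm_hasDerivWithin_le
    (f := fun x => T.eval x * Complex.exp (-Q.eval x)) (C := C₁ * ‖w‖ ^ N * D')
    (fun x _ => (hderiv x).hasDerivWithinAt) (fun x hx => by
      have hx' : ‖x‖ ≤ ‖w‖ := by simpa using hx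
      rw [norm_mul]
      refine mul_le_mul ((hC₁ x (hx'.trans hw)).trans ?_) (hD' x (by simpa using hx'.trans hw))
        (norm_nonneg _) (by positivity)
      gcongr) (x := 0) (y := w) (by simp) (by simp)
  have hT0 : T.eval 0 = 1 := by
    rw [← Polynomial.coeff_zero_eq_eval_zero, hTc 0 (Nat.zero_le _), h0]
  have hQ0 : Q.eval 0 = 0 := by rw [← hQe]; simp
  simp only [hT0, hQ0, neg_zero, Complex.exp_zero, mul_one, sub_zero] at hmv
  have hfac : Complex.exp (Q.eval w) - T.eval w =
      -(Complex.exp (Q.eval w) * (T.eval w * Complex.exp (-Q.eval w) - 1)) := by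
    rw [Complex.exp_neg]
    have := Complex.exp_ne_zero (Q.eval w)
    field_simp
    ring
  rw [hfac, norm_neg, norm_mul]
  calc _ ≤ D * (C₁ * ‖w‖ ^ N * D' * ‖w‖) := by
        gcongr
        exact hD w (by simpa using hw)
    _ = _ := by ring

/-! ### The constants `l`, `ρ`, `ν` in the Stirling expansion -/

lemma lCoeff_zero (A a : Fin p → ℝ) (B b : Fin q → ℝ) : lCoeff A a B b 0 = 1 := by
  rw [lCoeff]

lemma succ_mul_lCoeff_succ (A a : Fin p → ℝ) (B b : Fin q → ℝ) (r : ℕ) :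
    ((r : ℝ) + 1) * lCoeff A a B b (r + 1) =
      ∑ i ∈ Finset.range (r + 1), qCoeff A a B b (i + 1) * lCoeff A a B b (r - i) := by
  rw [lCoeff, ← Finset.sum_range (n := r + 1)
    (fun i => qCoeff A a B b (i + 1) * lCoeff A a B b (r - i))]
  have : (r : ℝ) + 1 ≠ 0 := by positivity
  field_simp

lemma rho_eq_exp {A : Fin p → ℝ} {B : Fin q → ℝ} (hA : ∀ k, 0 < A k) (hB : ∀ j, 0 < B j) :
    rho A B = Real.exp (∑ k, A k * Real.log (A k) - ∑ j, B j * Real.log (B j)) := by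
  rw [rho, Real.exp_sub, Real.exp_sum, Real.exp_sum, div_eq_mul_inv, ← Finset.prod_inv_distrib]
  congr 1
  · refine Finset.prod_congr rfl fun k _ => ?_
    rw [Real.rpow_def_of_pos (hA k), mul_comm]
  · refine Finset.prod_congr rfl fun j _ => ?_
    rw [Real.rpow_def_of_pos (hB j), ← Real.exp_neg]
    ring_nf

lemma rho_pos {A : Fin p → ℝ} {B : Fin q → ℝ} (hA : ∀ k, 0 < A k) (hB : ∀ j, 0 < B j) :
    0 < rho A B := by
  rw [rho_eq_exp hA hB]; exact Real.exp_pos _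

lemma rho_swap {A : Fin p → ℝ} {B : Fin q → ℝ} (hA : ∀ k, 0 < A k) (hB : ∀ j, 0 < B j) :
    rho B A = (rho A B)⁻¹ := by
  rw [rho_eq_exp hA hB, rho_eq_exp hB hA, ← Real.exp_neg, neg_sub]

lemma nu_eq_exp {A a : Fin p → ℝ} {B b : Fin q → ℝ} (hA : ∀ k, 0 < A k) (hB : ∀ j, 0 < B j) :
    nu A a B b = Real.exp
      (∑ k, ((a k - 1 / 2) * Real.log (A k) + Real.log (2 * Real.pi) / 2) -
        ∑ j, ((b j - 1 / 2) * Real.log (B j) + Real.log (2 * Real.pi) / 2)) := by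
  have h1 : ∏ k, A k ^ (a k - 1 / 2) = Real.exp (∑ k, (a k - 1 / 2) * Real.log (A k)) := by
    rw [Real.exp_sum]
    refine Finset.prod_congr rfl fun k _ => ?_
    rw [Real.rpow_def_of_pos (hA k), mul_comm]
  have h2 : ∏ j, B j ^ (1 / 2 - b j) = Real.exp (-∑ j, (b j - 1 / 2) * Real.log (B j)) := by
    rw [← Finset.sum_neg_distrib, Real.exp_sum]
    refine Finset.prod_congr rfl fun k _ => ?_
    rw [Real.rpow_def_of_pos (hB k)]
    ring_nf
  rw [nu, h1, h2, Real.rpow_def_of_pos (by positivity), ← Real.exp_add, ← Real.exp_add,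
    Finset.sum_add_distrib, Finset.sum_add_distrib]
  simp only [Finset.sum_const, Finset.card_univ, Fintype.card_fin, nsmul_eq_mul]
  ring_nf

lemma stirlingLog_mul (a : ℝ) (N : ℕ) {A : ℝ} (hA : 0 < A) {s : ℂ} (hs : s ≠ 0) :
    stirlingLog a N (A * s) = (A : ℂ) * (s * Complex.log s - s) +
      ((a - 1 / 2 : ℝ) : ℂ) * Complex.log s + s * ((A * Real.log A : ℝ) : ℂ) +
      (((a - 1 / 2) * Real.log A + Real.log (2 * Real.pi) / 2 : ℝ) : ℂ) +
      ∑ i ∈ Finset.range N, ((stirlingCoeff a i / A ^ (i + 1) : ℝ) : ℂ) * s⁻¹ ^ (i + 1) := by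
  rw [stirlingLog, Complex.log_ofReal_mul hA hs]
  have : ∀ i ∈ Finset.range N, (stirlingCoeff a i : ℂ) * ((A : ℂ) * s)⁻¹ ^ (i + 1) =
      ((stirlingCoeff a i / A ^ (i + 1) : ℝ) : ℂ) * s⁻¹ ^ (i + 1) := by
    intro i _
    push_cast
    rw [mul_inv, mul_pow, inv_pow, div_eq_mul_inv]
    ring
  rw [Finset.sum_congr rfl this]
  push_cast
  ring

lemma sum_stirlingLog (N : ℕ) (A a : Fin p → ℝ) (hA : ∀ k, 0 < A k) {s : ℂ} (hs : s ≠ 0) :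
    ∑ k, stirlingLog (a k) N (A k * s) = ((∑ k, A k : ℝ) : ℂ) * (s * Complex.log s - s) +
      ((∑ k, a k - p / 2 : ℝ) : ℂ) * Complex.log s + s * ((∑ k, A k * Real.log (A k) : ℝ) : ℂ) +
      ((∑ k, ((a k - 1 / 2) * Real.log (A k) + Real.log (2 * Real.pi) / 2) : ℝ) : ℂ) +
      ∑ i ∈ Finset.range N, ((∑ k, stirlingCoeff (a k) i / A k ^ (i + 1) : ℝ) : ℂ) *
        s⁻¹ ^ (i + 1) := by
  simp_rw [stirlingLog_mul _ N (hA _) hs]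
  rw [Finset.sum_add_distrib, Finset.sum_add_distrib, Finset.sum_add_distrib,
    Finset.sum_add_distrib, ← Finset.sum_mul, ← Finset.sum_mul, ← Finset.mul_sum,
    Finset.sum_comm, ← Complex.ofReal_sum, ← Complex.ofReal_sum, ← Complex.ofReal_sum,
    ← Complex.ofReal_sum]
  congr 1
  · congr 4
    simp [Finset.sum_sub_distrib]
    ring
  · refine Finset.sum_congr rfl fun i _ => ?_
    rw [← Finset.sum_mul, ← Complex.ofReal_sum]

/-- Identifies the Stirling series of the logarithm of the gamma ratio with the series `∑ q_{i+1}
w^(i+1)/(i+1)` whose exponential generates the `l_r`. -/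
lemma sum_stirlingCoeff_sub (A a : Fin p → ℝ) (B b : Fin q → ℝ) (i : ℕ) :
    ∑ k, stirlingCoeff (a k) i / A k ^ (i + 1) - ∑ j, stirlingCoeff (b j) i / B j ^ (i + 1) =
      qCoeff A a B b (i + 1) / (i + 1) := by
  have h : ∀ {r : ℕ} (A a : Fin r → ℝ), ∑ k, stirlingCoeff (a k) i / A k ^ (i + 1) =
      (-1) ^ i / (((i : ℝ) + 1) * (i + 2)) * ∑ k, bernoulliPoly (i + 1 + 1) (a k) /
        A k ^ (i + 1) := by
    intro r A a
    rw [Finset.mul_sum]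
    refine Finset.sum_congr rfl fun k _ => ?_
    rw [stirlingCoeff]
    ring
  rw [h, h, qCoeff]
  push_cast
  have h1 : (i : ℝ) + 1 ≠ 0 := by positivity
  have h2 : (i : ℝ) + 2 ≠ 0 := by positivity
  have h3 : (i : ℝ) + 1 + 1 ≠ 0 := by positivity
  rw [pow_succ (-1 : ℝ), pow_succ (-1 : ℝ)]
  field_simp
  ring

/-- Stirling's formula for a product of gamma functions. -/
lemma exists_prod_Gamma_eq_exp (N : ℕ) (A a : Fin p → ℝ) (hA : ∀ k, 0 < A k) :
    ∃ C R : ℝ, 0 ≤ C ∧ 1 ≤ R ∧ ∀ s ∈ sector, R ≤ ‖s‖ → ∃ e : ℂ, ‖e‖ ≤ C / ‖s‖ ^ (N + 1) ∧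
      ∏ k, Complex.Gamma ((A k : ℂ) * s + a k) =
        Complex.exp (∑ k, stirlingLog (a k) N (A k * s) + e) := by
  choose C R hC hR h using fun k => exists_Gamma_eq_exp_stirlingLog (a k) N
  have hq : ∀ k, 0 ≤ R k / A k := fun k => div_nonneg (hR k).le (hA k).le
  refine ⟨∑ k, C k / A k ^ (N + 1), 1 + ∑ k, R k / A k,
    Finset.sum_nonneg fun k _ => div_nonneg (hC k) (pow_nonneg (hA k).le _), ?_, fun s hs hsR => ?_⟩
  · have := Finset.sum_nonneg fun k (_ : k ∈ Finset.univ) => hq k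
    linarith
  have hn : ∀ k, ‖(A k : ℂ) * s‖ = A k * ‖s‖ := fun k => by
    rw [norm_mul, Complex.norm_real, Real.norm_eq_abs, abs_of_pos (hA k)]
  have hl : ∀ k, R k ≤ ‖(A k : ℂ) * s‖ := fun k => by
    have h1 : R k / A k ≤ ∑ k, R k / A k :=
      Finset.single_le_sum (f := fun k => R k / A k) (fun k _ => hq k) (Finset.mem_univ k)
    have h2 : R k / A k ≤ ‖s‖ := by linarith
    rw [hn, mul_comm]
    exact (div_le_iff₀ (hA k)).1 h2
  choose e he hG using fun k => h k ((A k : ℂ) * s) (sector_mul hs (hA k).le) (hl k)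
  refine ⟨∑ k, e k, ?_, ?_⟩
  · refine (norm_sum_le _ _).trans ?_
    rw [Finset.sum_div]
    refine Finset.sum_le_sum fun k _ => (he k).trans (le_of_eq ?_)
    rw [hn, mul_pow, div_div]
  · rw [← Finset.sum_add_distrib, Complex.exp_sum]
    exact Finset.prod_congr rfl fun k _ => hG k

/-- The polynomial `ν ∑ₖ l_{m-k} sᵏ`, the principal part of `ρ^(-s)` times the gamma ratio. -/
def principalPart (A a : Fin p → ℝ) (B b : Fin q → ℝ) (m : ℕ) (s : ℂ) : ℂ :=
  (nu A a B b : ℂ) * ∑ k ∈ Finset.range (m + 1), (lCoeff A a B b (m - k) : ℂ) * s ^ k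

lemma sum_lCoeff_mul_pow {l : ℕ → ℂ} (m : ℕ) {s : ℂ} (hs : s ≠ 0) :
    s ^ m * ∑ r ∈ Finset.range (m + 1), l r * s⁻¹ ^ r =
      ∑ k ∈ Finset.range (m + 1), l (m - k) * s ^ k := by
  rw [← Finset.sum_range_reflect, Finset.mul_sum]
  refine Finset.sum_congr rfl fun k hk => ?_
  have hk' : k ≤ m := Nat.lt_succ_iff.1 (Finset.mem_range.1 hk)
  rw [show m + 1 - 1 - k = m - k by omega]
  have : s ^ m = s ^ k * s ^ (m - k) := by rw [← pow_add]; congr 1; omega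
  rw [this, inv_pow]
  field_simp

/-- In the difference of the two sums of Stirling series, `s log s - s` has coefficient `∑ A - ∑ B =
0`, `log s` has coefficient `-μ = m`, the linear term is `s log ρ` and the constant is `log ν`. The
negative powers exponentiate to `∑ l_r s^(-r)`. With `m` correction terms the relative error is
`O(|s|^(-m-1))`, which the factor `s^m` turns into `O(1/|s|)`. -/
theorem exists_norm_gammaRatio_sub_le {A a : Fin p → ℝ} {B b : Fin q → ℝ}
    (hA : ∀ k, 0 < A k) (hB : ∀ j, 0 < B j) (hΔ : Delta A B = 0) {m : ℕ}
    (hμ : mu a b = -(m : ℝ)) :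
    ∃ C R : ℝ, 0 ≤ C ∧ 1 ≤ R ∧ ∀ s ∈ sector, R ≤ ‖s‖ →
      ‖gammaRatio A a B b s * (rho A B : ℂ) ^ (-s) - principalPart A a B b m s‖ ≤ C / ‖s‖ := by
  obtain ⟨C₁, R₁, hC₁, hR₁, h₁⟩ := exists_prod_Gamma_eq_exp m A a hA
  obtain ⟨C₂, R₂, hC₂, hR₂, h₂⟩ := exists_prod_Gamma_eq_exp m B b hB
  obtain ⟨C₃, D, hC₃, hD, h₃⟩ := exists_norm_exp_sub_sum_le m
    (fun i => (qCoeff A a B b (i + 1) : ℂ)) (fun r => (lCoeff A a B b r : ℂ))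
    (by rw [lCoeff_zero]; simp) (fun r => by exact_mod_cast succ_mul_lCoeff_succ A a B b r)
  have hν : 0 < nu A a B b := by rw [nu_eq_exp hA hB]; exact Real.exp_pos _
  -- The summand `C₁ + C₂` in the radius makes `‖e₁ - e₂‖ ≤ 1`, as the linear bound for `exp - 1`
  -- requires.
  refine ⟨nu A a B b * (2 * D * (C₁ + C₂) + C₃), R₁ + R₂ + (C₁ + C₂), by positivity,
    by linarith, fun s hs hsR => ?_⟩
  have hs1 : 1 ≤ ‖s‖ := by linarith
  have hs0 : s ≠ 0 := norm_pos_iff.1 (by linarith)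
  obtain ⟨e₁, he₁, hG₁⟩ := h₁ s hs (by linarith)
  obtain ⟨e₂, he₂, hG₂⟩ := h₂ s hs (by linarith)
  have he : ‖e₁ - e₂‖ ≤ (C₁ + C₂) / ‖s‖ ^ (m + 1) := by
    rw [add_div]
    exact (norm_sub_le _ _).trans (add_le_add he₁ he₂)
  have he1 : ‖e₁ - e₂‖ ≤ 1 := by
    refine he.trans ?_
    rw [div_le_one (by positivity)]
    calc C₁ + C₂ ≤ ‖s‖ := by linarith
      _ ≤ ‖s‖ ^ (m + 1) := le_self_pow₀ hs1 (Nat.succ_ne_zero m)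
  set E := Complex.exp (∑ i ∈ Finset.range m,
    (qCoeff A a B b (i + 1) : ℂ) / ((i : ℂ) + 1) * s⁻¹ ^ (i + 1)) with hE
  have hsi : ‖s⁻¹‖ ≤ 1 := by rw [norm_inv]; exact inv_le_one_of_one_le₀ hs1
  obtain ⟨hED, hET⟩ := h₃ s⁻¹ hsi
  rw [← hE] at hED hET
  have hG : gammaRatio A a B b s * (rho A B : ℂ) ^ (-s) =
      (nu A a B b : ℂ) * s ^ m * E * Complex.exp (e₁ - e₂) := by
    have hΔ' : ∑ j, B j = ∑ k, A k := sub_eq_zero.1 hΔ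
    have hμ' : ∑ k, a k - p / 2 - (∑ j, b j - q / 2) = (m : ℝ) := by
      rw [mu] at hμ; linarith
    have hsm : s ^ m = Complex.exp (m * Complex.log s) := by
      rw [Complex.exp_nat_mul, Complex.exp_log hs0]
    rw [gammaRatio, hG₁, hG₂, ← Complex.exp_sub, Complex.cpow_def_of_ne_zero
      (by exact_mod_cast (rho_pos hA hB).ne'), ← Complex.ofReal_log (rho_pos hA hB).le,
      nu_eq_exp hA hB, rho_eq_exp hA hB, Real.log_exp, hsm, hE, Complex.ofReal_exp,
      ← Complex.exp_add, ← Complex.exp_add, ← Complex.exp_add, ← Complex.exp_add]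
    congr 1
    have hq : ∑ i ∈ Finset.range m, (qCoeff A a B b (i + 1) : ℂ) / ((i : ℂ) + 1) * s⁻¹ ^ (i + 1) =
        ∑ i ∈ Finset.range m, ((∑ k, stirlingCoeff (a k) i / A k ^ (i + 1) : ℝ) : ℂ) *
          s⁻¹ ^ (i + 1) - ∑ i ∈ Finset.range m,
          ((∑ j, stirlingCoeff (b j) i / B j ^ (i + 1) : ℝ) : ℂ) * s⁻¹ ^ (i + 1) := by
      rw [← Finset.sum_sub_distrib]
      refine Finset.sum_congr rfl fun i _ => ?_
      rw [← sub_mul, ← Complex.ofReal_sub, sum_stirlingCoeff_sub]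
      push_cast
      rfl
    have hm : (m : ℂ) = ((∑ k, a k - p / 2 : ℝ) : ℂ) - ((∑ j, b j - q / 2 : ℝ) : ℂ) := by
      rw [← Complex.ofReal_sub, hμ', Complex.ofReal_natCast]
    rw [sum_stirlingLog m A a hA hs0, sum_stirlingLog m B b hB hs0, hq, hm, hΔ']
    simp only [Complex.ofReal_sub]
    ring
  have hP : principalPart A a B b m s = (nu A a B b : ℂ) * s ^ m *
      ∑ r ∈ Finset.range (m + 1), (lCoeff A a B b r : ℂ) * s⁻¹ ^ r := by
    rw [mul_assoc, sum_lCoeff_mul_pow m hs0, principalPart]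
  have hdiff : gammaRatio A a B b s * (rho A B : ℂ) ^ (-s) - principalPart A a B b m s =
      (nu A a B b : ℂ) * s ^ m * (E * (Complex.exp (e₁ - e₂) - 1) +
        (E - ∑ r ∈ Finset.range (m + 1), (lCoeff A a B b r : ℂ) * s⁻¹ ^ r)) := by
    rw [hG, hP]; ring
  rw [hdiff, norm_mul, norm_mul, norm_pow, Complex.norm_real, Real.norm_eq_abs, abs_of_pos hν]
  have hexp : ‖Complex.exp (e₁ - e₂) - 1‖ ≤ 2 * ((C₁ + C₂) / ‖s‖ ^ (m + 1)) :=
    (Complex.norm_exp_sub_one_le he1).trans (by gcongr)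
  have hspos : 0 < ‖s‖ := by linarith
  calc _ ≤ nu A a B b * ‖s‖ ^ m * (D * (2 * ((C₁ + C₂) / ‖s‖ ^ (m + 1))) +
        C₃ * ‖s⁻¹‖ ^ (m + 1)) := by
        gcongr
        refine (norm_add_le _ _).trans (add_le_add ?_ hET)
        rw [norm_mul]
        exact mul_le_mul hED hexp (norm_nonneg _) hD
    _ = _ := by
        rw [norm_inv, inv_pow, pow_succ]
        field_simp

/-! ### Analyticity and bounds of the gamma ratio -/

/-- The plane slit along `(-∞, γ]`. -/
def slit (γ : ℝ) : Set ℂ := {z | z - γ ∈ Complex.slitPlane}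

lemma mem_slit {γ : ℝ} {z : ℂ} : z ∈ slit γ ↔ γ < z.re ∨ z.im ≠ 0 := by
  simp [slit, Complex.mem_slitPlane_iff]

lemma isOpen_slit (γ : ℝ) : IsOpen (slit γ) :=
  Complex.isOpen_slitPlane.preimage (continuous_id.sub continuous_const)

lemma neg_div_le_gam (A a : Fin p → ℝ) (k : Fin p) : -(a k / A k) ≤ gam A a :=
  neg_le_neg (ciInf_le (Set.finite_range _).bddBelow k)

/-- A pole of the numerator satisfies `A_k z + a_k = -n`, so it is real and at most `-a_k/A_k ≤ γ`;
the denominator causes none because `1/Γ` is entire. -/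
lemma differentiableOn_gammaRatio {A a : Fin p → ℝ} (B b : Fin q → ℝ) (hA : ∀ k, 0 < A k) :
    DifferentiableOn ℂ (gammaRatio A a B b) (slit (gam A a)) := by
  intro z hz
  refine DifferentiableAt.differentiableWithinAt ?_
  have h1 : gammaRatio A a B b = fun z => (∏ k, Complex.Gamma ((A k : ℂ) * z + a k)) *
      ∏ j, (Complex.Gamma ((B j : ℂ) * z + b j))⁻¹ := by
    ext z
    rw [gammaRatio, div_eq_mul_inv, Finset.prod_inv_distrib]
  rw [h1]
  refine DifferentiableAt.mul ?_ ?_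
  · refine DifferentiableAt.fun_finsetProd fun k _ => ?_
    refine DifferentiableAt.comp z (Complex.differentiableAt_Gamma _ fun n hn => ?_) (by fun_prop)
    rcases mem_slit.1 hz with h | h
    · have h2 := congrArg Complex.re hn
      simp only [Complex.add_re, Complex.re_ofReal_mul, Complex.ofReal_re, Complex.neg_re,
        Complex.natCast_re] at h2
      have h3 := (neg_div_le_gam A a k).trans_lt h
      rw [neg_lt, ← sub_pos, sub_neg_eq_add] at h3
      have h4 := mul_pos (hA k) h3
      rw [mul_add, mul_div_cancel₀ _ (hA k).ne'] at h4
      have : (0 : ℝ) ≤ n := Nat.cast_nonneg n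
      linarith
    · have h2 := congrArg Complex.im hn
      simp only [Complex.add_im, Complex.im_ofReal_mul, Complex.ofReal_im, Complex.neg_im,
        Complex.natCast_im, add_zero, neg_zero, mul_eq_zero, h, or_false] at h2
      exact (hA k).ne' h2
  · refine DifferentiableAt.fun_finsetProd fun j _ => ?_
    exact (Complex.differentiable_one_div_Gamma _).comp z (by fun_prop)

/-- The remainder `ρ^(-s) ∏ₖ Γ(Aₖ s + aₖ) / ∏ⱼ Γ(Bⱼ s + bⱼ) - ν ∑ₖ l_{m-k} sᵏ`. -/
def remainder (A a : Fin p → ℝ) (B b : Fin q → ℝ) (m : ℕ) (s : ℂ) : ℂ :=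
  gammaRatio A a B b s * (rho A B : ℂ) ^ (-s) - principalPart A a B b m s

lemma differentiable_principalPart (A a : Fin p → ℝ) (B b : Fin q → ℝ) (m : ℕ) :
    Differentiable ℂ (principalPart A a B b m) := by
  unfold principalPart
  fun_prop

lemma exists_norm_principalPart_le (A a : Fin p → ℝ) (B b : Fin q → ℝ) (m : ℕ) :
    ∃ C, 0 ≤ C ∧ ∀ s, ‖principalPart A a B b m s‖ ≤ C * (1 + ‖s‖) ^ m := by
  refine ⟨‖(nu A a B b : ℂ)‖ * ∑ k ∈ Finset.range (m + 1), ‖(lCoeff A a B b (m - k) : ℂ)‖,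
    by positivity, fun s => ?_⟩
  rw [principalPart, norm_mul, mul_assoc, Finset.sum_mul]
  gcongr
  refine (norm_sum_le _ _).trans (Finset.sum_le_sum fun k hk => ?_)
  rw [norm_mul, norm_pow]
  gcongr
  calc ‖s‖ ^ k ≤ (1 + ‖s‖) ^ k := by gcongr; linarith
    _ ≤ (1 + ‖s‖) ^ m := pow_le_pow_right₀ (by linarith [norm_nonneg s])
        (Nat.lt_succ_iff.1 (Finset.mem_range.1 hk))

lemma differentiable_rho_cpow_neg {A : Fin p → ℝ} {B : Fin q → ℝ} (hA : ∀ k, 0 < A k)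
    (hB : ∀ j, 0 < B j) : Differentiable ℂ fun s : ℂ => (rho A B : ℂ) ^ (-s) := by
  intro s
  refine DifferentiableAt.const_cpow (by fun_prop) (Or.inl ?_)
  exact_mod_cast (rho_pos hA hB).ne'

lemma differentiableOn_remainder {A a : Fin p → ℝ} {B : Fin q → ℝ} (b : Fin q → ℝ)
    (hA : ∀ k, 0 < A k) (hB : ∀ j, 0 < B j) (m : ℕ) :
    DifferentiableOn ℂ (remainder A a B b m) (slit (gam A a)) :=
  ((differentiableOn_gammaRatio B b hA).mul
    (differentiable_rho_cpow_neg hA hB).differentiableOn).sub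
    (differentiable_principalPart A a B b m).differentiableOn

/-- The closed region to the right of the rays from `c` in the directions `-1 ± 2i`. -/
def rightRegion (c : ℝ) : Set ℂ := {z | c - |z.im| / 2 ≤ z.re}

lemma isClosed_rightRegion (c : ℝ) : IsClosed (rightRegion c) :=
  isClosed_le (by fun_prop) (by fun_prop)

lemma rightRegion_subset_slit {γ c : ℝ} (h : γ < c) : rightRegion c ⊆ slit γ := by
  intro z hz
  rw [mem_slit]
  by_cases hi : z.im = 0
  · left
    have hz' : c - |z.im| / 2 ≤ z.re := hz
    rw [hi, abs_zero, zero_div, sub_zero] at hz'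
    linarith
  · exact Or.inr hi

/-- The boundary rays of the region are steeper than those of the sector, so only a bounded part of
the region can stick out. -/
lemma mem_sector_of_mem_rightRegion {c : ℝ} {z : ℂ} (hz : z ∈ rightRegion c)
    (h : 4 * |c| < ‖z‖) : z ∈ sector := by
  have hz' : c - |z.im| / 2 ≤ z.re := hz
  change -|z.im| ≤ z.re
  by_contra! hlt
  have h1 := Complex.norm_le_abs_re_add_abs_im z
  have h2 := neg_abs_le c
  have h3 := abs_nonneg z.im
  have h4 : |z.re| = -z.re := abs_of_neg (by linarith)
  linarith

/-- Stirling's estimate covers large `z`; the rest of the region is compact and misses the slit, so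
continuity suffices. -/
theorem exists_norm_remainder_le {A a : Fin p → ℝ} {B b : Fin q → ℝ}
    (hA : ∀ k, 0 < A k) (hB : ∀ j, 0 < B j) (hΔ : Delta A B = 0) {m : ℕ}
    (hμ : mu a b = -(m : ℝ)) {c : ℝ} (hc : gam A a < c) :
    ∃ C, 0 ≤ C ∧ ∀ z ∈ rightRegion c, ‖remainder A a B b m z‖ ≤ C / (1 + ‖z‖) := by
  obtain ⟨C, R, hC, hR, h⟩ := exists_norm_gammaRatio_sub_le hA hB hΔ hμ
  set R' := R + 4 * |c| + 1 with hR'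
  obtain ⟨C₂, hC₂⟩ := ((isCompact_closedBall (0 : ℂ) R').inter_left
    (isClosed_rightRegion c)).exists_bound_of_continuousOn (f := remainder A a B b m)
    ((differentiableOn_remainder b hA hB m).continuousOn.mono
      (Set.inter_subset_left.trans (rightRegion_subset_slit hc)))
  have hc0 := abs_nonneg c
  refine ⟨2 * C + |C₂| * (1 + R'), by positivity, fun z hz => ?_⟩
  have hz1 : 0 < 1 + ‖z‖ := by positivity
  rw [le_div_iff₀ hz1]
  rcases le_or_gt ‖z‖ R' with hzR | hzR
  · have h1 := (hC₂ z ⟨hz, by simpa using hzR⟩).trans (le_abs_self C₂)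
    calc _ ≤ |C₂| * (1 + R') := by gcongr
      _ ≤ _ := by linarith
  · have h1 := h z (mem_sector_of_mem_rightRegion hz (by linarith)) (by linarith)
    have hz0 : 0 < ‖z‖ := by linarith
    calc ‖remainder A a B b m z‖ * (1 + ‖z‖) ≤ C / ‖z‖ * (‖z‖ + ‖z‖) := by
          gcongr
          · exact h1
          · linarith
      _ = 2 * C := by field_simp; ring
      _ ≤ _ := by
          have : 0 ≤ |C₂| * (1 + R') := by positivity
          linarith

lemma exists_norm_gammaRatio_le {A a : Fin p → ℝ} {B b : Fin q → ℝ}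
    (hA : ∀ k, 0 < A k) (hB : ∀ j, 0 < B j) (hΔ : Delta A B = 0) {m : ℕ}
    (hμ : mu a b = -(m : ℝ)) :
    ∃ C R, 0 ≤ C ∧ 1 ≤ R ∧ ∀ z ∈ sector, R ≤ ‖z‖ →
      ‖gammaRatio A a B b z * (rho A B : ℂ) ^ (-z)‖ ≤ C * (1 + ‖z‖) ^ m := by
  obtain ⟨C, R, hC, hR, h⟩ := exists_norm_gammaRatio_sub_le hA hB hΔ hμ
  obtain ⟨C₂, hC₂0, hC₂⟩ := exists_norm_principalPart_le A a B b m
  refine ⟨C + C₂, R, by positivity, hR, fun z hz hzR => ?_⟩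
  have h1 := h z hz hzR
  have h2 := hC₂ z
  have h3 : C / ‖z‖ ≤ C * (1 + ‖z‖) ^ m := by
    calc C / ‖z‖ ≤ C := div_le_self hC (by linarith)
      _ ≤ C * (1 + ‖z‖) ^ m := le_mul_of_one_le_right hC (one_le_pow₀ (by
          linarith [norm_nonneg z]))
  calc _ = ‖(gammaRatio A a B b z * (rho A B : ℂ) ^ (-z) - principalPart A a B b m z) +
        principalPart A a B b m z‖ := by rw [sub_add_cancel]
    _ ≤ _ := (norm_add_le _ _).trans (by linarith)

/-! ### The reflection formula and growth on the left -/

lemma norm_sin_le (w : ℂ) : ‖Complex.sin w‖ ≤ Real.exp |w.im| := by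
  rw [Complex.sin, norm_div, norm_mul, Complex.norm_I, mul_one]
  have h1 := norm_sub_le (Complex.exp (-w * Complex.I)) (Complex.exp (w * Complex.I))
  rw [Complex.norm_exp, Complex.norm_exp] at h1
  simp only [neg_mul, Complex.neg_re, Complex.mul_I_re, neg_neg] at h1
  have h2 : Real.exp w.im ≤ Real.exp |w.im| := Real.exp_le_exp.2 (le_abs_self _)
  have h3 : Real.exp (-w.im) ≤ Real.exp |w.im| := Real.exp_le_exp.2 (neg_le_abs _)
  rw [Complex.norm_two, neg_mul]
  linarith

lemma le_norm_sin {w : ℂ} {v : ℝ} (hv : v ≤ |w.im|) :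
    (1 - Real.exp (-2 * v)) / 2 * Real.exp |w.im| ≤ ‖Complex.sin w‖ := by
  rw [Complex.sin, norm_div, norm_mul, Complex.norm_I, mul_one, Complex.norm_two]
  have h1 : Real.exp |w.im| - Real.exp (-|w.im|) ≤
      ‖Complex.exp (-w * Complex.I) - Complex.exp (w * Complex.I)‖ := by
    have e1 : ‖Complex.exp (-w * Complex.I)‖ = Real.exp w.im := by
      rw [Complex.norm_exp]; simp
    have e2 : ‖Complex.exp (w * Complex.I)‖ = Real.exp (-w.im) := by
      rw [Complex.norm_exp]; simp
    rcases abs_cases w.im with ⟨h, _⟩ | ⟨h, _⟩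
    · rw [h, ← e1, ← e2]; exact norm_sub_norm_le _ _
    · rw [h, neg_neg, ← e1, ← e2, norm_sub_rev]; exact norm_sub_norm_le _ _
  have h2 : Real.exp (-|w.im|) ≤ Real.exp (-2 * v) * Real.exp |w.im| := by
    rw [← Real.exp_add]; exact Real.exp_le_exp.2 (by linarith)
  linarith

lemma Gamma_eq_pi_div (z : ℂ) (hz : z.im ≠ 0) :
    Complex.Gamma z = Real.pi / Complex.sin (Real.pi * z) * (Complex.Gamma (1 - z))⁻¹ := by
  have h : Complex.Gamma (1 - z) ≠ 0 := Complex.Gamma_ne_zero fun n hn => hz (by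
    have := congrArg Complex.im hn
    simpa using this)
  rw [← Complex.Gamma_mul_Gamma_one_sub, mul_assoc, mul_inv_cancel₀ h, mul_one]

lemma prod_Gamma_eq (A a : Fin p → ℝ) (hA : ∀ k, 0 < A k) {z : ℂ} (hz : z.im ≠ 0) :
    ∏ k, Complex.Gamma ((A k : ℂ) * z + a k) =
      (∏ k, (Real.pi / Complex.sin (Real.pi * ((A k : ℂ) * z + a k)))) *
        (∏ k, Complex.Gamma ((A k : ℂ) * (-z) + ((1 - a k : ℝ) : ℂ)))⁻¹ := by
  rw [← Finset.prod_inv_distrib, ← Finset.prod_mul_distrib]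
  refine Finset.prod_congr rfl fun k _ => ?_
  rw [Gamma_eq_pi_div _ (by simpa using ⟨(hA k).ne', hz⟩)]
  congr 3
  push_cast
  ring

/-- Since `1 - (A z + a) = A (-z) + (1 - a)`, reflecting every factor exchanges the two families and
moves the argument to `-z`, where Stirling's formula is available when `z` lies far to the left. -/
lemma gammaRatio_reflect {A a : Fin p → ℝ} {B b : Fin q → ℝ}
    (hA : ∀ k, 0 < A k) (hB : ∀ j, 0 < B j) {z : ℂ} (hz : z.im ≠ 0) :
    gammaRatio A a B b z =
      (∏ k, (Real.pi / Complex.sin (Real.pi * ((A k : ℂ) * z + a k)))) *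
      (∏ j, (Real.pi / Complex.sin (Real.pi * ((B j : ℂ) * z + b j))))⁻¹ *
      gammaRatio B (fun j => 1 - b j) A (fun k => 1 - a k) (-z) := by
  rw [gammaRatio, gammaRatio, prod_Gamma_eq A a hA hz, prod_Gamma_eq B b hB hz]
  rw [div_eq_mul_inv, mul_inv, inv_inv]
  ring

lemma norm_prod_pi_div_sin_le (A a : Fin p → ℝ) (hA : ∀ k, 0 < A k) {φ : ℝ} (hφ : 0 < φ) :
    ∃ C, 0 ≤ C ∧ ∀ z : ℂ, φ ≤ |z.im| →
      ‖∏ k, (Real.pi / Complex.sin (Real.pi * ((A k : ℂ) * z + a k)))‖ ≤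
        C * Real.exp (-(Real.pi * (∑ k, A k) * |z.im|)) := by
  have hD : ∀ k, 0 < (1 - Real.exp (-2 * (Real.pi * A k * φ))) / 2 := fun k => by
    have : Real.exp (-2 * (Real.pi * A k * φ)) < 1 := Real.exp_lt_one_iff.2 (by
      have := mul_pos (mul_pos Real.pi_pos (hA k)) hφ
      linarith)
    linarith
  refine ⟨∏ k, (Real.pi / ((1 - Real.exp (-2 * (Real.pi * A k * φ))) / 2)),
    Finset.prod_nonneg fun k _ => div_nonneg Real.pi_pos.le (hD k).le, fun z hz => ?_⟩
  rw [norm_prod, Finset.mul_sum, Finset.sum_mul, ← Finset.sum_neg_distrib, Real.exp_sum,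
    ← Finset.prod_mul_distrib]
  refine Finset.prod_le_prod (fun _ _ => norm_nonneg _) fun k _ => ?_
  have him : (Real.pi * ((A k : ℂ) * z + a k)).im = Real.pi * A k * z.im := by
    simp [mul_assoc]
  have habs : |(Real.pi * ((A k : ℂ) * z + a k)).im| = Real.pi * A k * |z.im| := by
    rw [him, abs_mul, abs_of_pos (mul_pos Real.pi_pos (hA k))]
  have h := le_norm_sin (w := Real.pi * ((A k : ℂ) * z + a k)) (v := Real.pi * A k * φ) (by
    rw [habs]
    exact mul_le_mul_of_nonneg_left hz (mul_pos Real.pi_pos (hA k)).le)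
  rw [habs] at h
  rw [norm_div, Complex.norm_real, Real.norm_eq_abs, abs_of_pos Real.pi_pos, Real.exp_neg,
    ← div_eq_mul_inv, div_div]
  have := mul_pos (hD k) (Real.exp_pos (Real.pi * A k * |z.im|))
  gcongr

lemma norm_prod_pi_div_sin_inv_le (B b : Fin q → ℝ) (hB : ∀ j, 0 < B j) (z : ℂ) :
      ‖(∏ j, (Real.pi / Complex.sin (Real.pi * ((B j : ℂ) * z + b j))))⁻¹‖ ≤
        (∏ _j : Fin q, Real.pi⁻¹) * Real.exp (Real.pi * (∑ j, B j) * |z.im|) := by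
  rw [← Finset.prod_inv_distrib, norm_prod, Finset.mul_sum, Finset.sum_mul, Real.exp_sum,
    ← Finset.prod_mul_distrib]
  refine Finset.prod_le_prod (fun _ _ => norm_nonneg _) fun j _ => ?_
  have him : (Real.pi * ((B j : ℂ) * z + b j)).im = Real.pi * B j * z.im := by
    simp [mul_assoc]
  have h := norm_sin_le (Real.pi * ((B j : ℂ) * z + b j))
  rw [him, abs_mul, abs_of_pos (mul_pos Real.pi_pos (hB j))] at h
  rw [inv_div, norm_div, Complex.norm_real, Real.norm_eq_abs, abs_of_pos Real.pi_pos,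
    div_eq_inv_mul]
  have := Real.pi_pos
  gcongr

/-- A polynomial bound for `ρ^(-z)` times the gamma ratio on the left, away from the real axis. -/
theorem exists_norm_gammaRatio_le_left {A a : Fin p → ℝ} {B b : Fin q → ℝ}
    (hA : ∀ k, 0 < A k) (hB : ∀ j, 0 < B j) (hΔ : Delta A B = 0) {m : ℕ}
    (hμ : mu a b = -(m : ℝ)) (c : ℝ) {φ : ℝ} (hφ : 0 < φ) :
    ∃ C, 0 ≤ C ∧ ∀ z : ℂ, z.re ≤ c → φ ≤ |z.im| →
      ‖gammaRatio A a B b z * (rho A B : ℂ) ^ (-z)‖ ≤ C * (1 + ‖z‖) ^ m := by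
  have hΔ' : Delta B A = 0 := by rw [Delta] at *; linarith
  -- Reflection preserves `μ`, so the polynomial bound for the reflected ratio has the same degree
  -- `m`.
  have hμ' : mu (fun j => 1 - b j) (fun k => 1 - a k) = -(m : ℝ) := by
    rw [← hμ, mu, mu]
    simp only [Finset.sum_sub_distrib, Finset.sum_const, Finset.card_univ, Fintype.card_fin,
      nsmul_eq_mul, mul_one]
    ring
  obtain ⟨C, R, hC, hR, h⟩ := exists_norm_gammaRatio_le hB hA hΔ' hμ'
  obtain ⟨C₁, hC₁0, hC₁⟩ := norm_prod_pi_div_sin_le A a hA hφ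
  set R' := R + 2 * |c| with hR'
  have hclosed : IsClosed {z : ℂ | φ ≤ |z.im|} := isClosed_le (by fun_prop) (by fun_prop)
  obtain ⟨C₂, hC₂⟩ := ((isCompact_closedBall (0 : ℂ) R').inter_left
    hclosed).exists_bound_of_continuousOn
    (f := fun z => gammaRatio A a B b z * (rho A B : ℂ) ^ (-z))
    (((differentiableOn_gammaRatio B b hA).continuousOn.mul
      (differentiable_rho_cpow_neg hA hB).continuous.continuousOn).mono (by
        rintro z ⟨hz, -⟩
        have hz' : φ ≤ |z.im| := hz
        exact mem_slit.2 (Or.inr (abs_pos.1 (hφ.trans_le hz')))))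
  set Cπ : ℝ := ∏ _j : Fin q, Real.pi⁻¹ with hCπ
  have hCπ0 : 0 ≤ Cπ := Finset.prod_nonneg fun _ _ => inv_nonneg.2 Real.pi_pos.le
  refine ⟨|C₂| + C₁ * Cπ * C, by positivity, fun z hzc hzφ => ?_⟩
  have hzn := norm_nonneg z
  have hpow : 1 ≤ (1 + ‖z‖) ^ m := one_le_pow₀ (by linarith)
  rw [add_mul]
  rcases le_or_gt ‖z‖ R' with hzR | hzR
  · have h1 := (hC₂ z ⟨hzφ, by simpa using hzR⟩).trans (le_abs_self C₂)
    have h2 : |C₂| ≤ |C₂| * (1 + ‖z‖) ^ m := le_mul_of_one_le_right (abs_nonneg _) hpow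
    have h3 : 0 ≤ C₁ * Cπ * C * (1 + ‖z‖) ^ m := by positivity
    linarith
  · have hz0 : z.im ≠ 0 := abs_pos.1 (hφ.trans_le hzφ)
    have hsec : -z ∈ sector := by
      change -|(-z).im| ≤ (-z).re
      rw [Complex.neg_im, Complex.neg_re, abs_neg]
      by_contra! hlt
      have h1 := Complex.norm_le_abs_re_add_abs_im z
      have h4 : |z.re| = z.re := abs_of_pos (by linarith [abs_nonneg z.im])
      have := le_abs_self c
      linarith [abs_nonneg z.im]
    have hc0 := abs_nonneg c
    have h1 := h (-z) hsec (by rw [norm_neg]; linarith)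
    rw [norm_neg, neg_neg] at h1
    have hrho : (rho B A : ℂ) ^ z = (rho A B : ℂ) ^ (-z) := by
      rw [rho_swap hA hB, Complex.ofReal_inv, Complex.inv_cpow, Complex.cpow_neg]
      rw [Complex.arg_ofReal_of_nonneg (rho_pos hA hB).le]
      exact Real.pi_ne_zero.symm
    rw [hrho] at h1
    have hΔ'' : ∑ j, B j = ∑ k, A k := sub_eq_zero.1 hΔ
    have h2 := hC₁ z hzφ
    have h3 := norm_prod_pi_div_sin_inv_le B b hB z
    rw [hΔ''] at h3
    rw [gammaRatio_reflect hA hB hz0, mul_assoc, norm_mul, norm_mul]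
    have h4 : 0 ≤ |C₂| * (1 + ‖z‖) ^ m := by positivity
    -- The sines in numerator and denominator have exactly opposite exponential rates because `∑ B =
    -- ∑ A`.
    calc _ ≤ (C₁ * Real.exp (-(Real.pi * (∑ k, A k) * |z.im|))) *
          (Cπ * Real.exp (Real.pi * (∑ k, A k) * |z.im|)) * (C * (1 + ‖z‖) ^ m) := by
          gcongr
      _ = C₁ * Cπ * C * (1 + ‖z‖) ^ m := by
          rw [Real.exp_neg]
          have := (Real.exp_pos (Real.pi * (∑ k, A k) * |z.im|)).ne'
          field_simp
      _ ≤ _ := by linarith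

/-! ### Primitives on the slit plane and loop integrals -/

/-- The map `w ↦ γ + exp w` sends the convex strip `|Im w| < π` onto the slit plane. A primitive of
the pulled-back form on the strip is carried back by the logarithm. -/
lemma exists_primitive_slit {γ : ℝ} {f : ℂ → ℂ} (hf : DifferentiableOn ℂ f (slit γ)) :
    ∃ F : ℂ → ℂ, ∀ z ∈ slit γ, HasDerivAt F (f z) z := by
  set S : Set ℂ := {w | w.im ∈ Set.Ioo (-Real.pi) Real.pi} with hS
  have hSo : IsOpen S := isOpen_Ioo.preimage Complex.continuous_im
  have hSc : Convex ℝ S := (convex_Ioo (-Real.pi) Real.pi).linear_preimage Complex.imLm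
  have hexp : ∀ w ∈ S, (γ : ℂ) + Complex.exp w ∈ slit γ := by
    intro w hw
    change (γ : ℂ) + Complex.exp w - γ ∈ Complex.slitPlane
    rw [add_sub_cancel_left, Complex.mem_slitPlane_iff_arg]
    refine ⟨?_, Complex.exp_ne_zero _⟩
    have h1 : Complex.log (Complex.exp w) = w := Complex.log_exp hw.1 hw.2.le
    have h2 := congrArg Complex.im h1
    rw [Complex.log_im] at h2
    rw [h2]
    exact hw.2.ne
  have hg : DifferentiableOn ℂ (fun w => f (γ + Complex.exp w) * Complex.exp w) S := by
    refine DifferentiableOn.mul ?_ Complex.differentiable_exp.differentiableOn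
    exact hf.comp ((Complex.differentiable_exp.const_add _).differentiableOn) hexp
  obtain ⟨g, hg⟩ := hSc.exists_forall_hasDerivWithinAt hg
  refine ⟨fun z => g (Complex.log (z - γ)), fun z hz => ?_⟩
  have hz' : z - γ ∈ Complex.slitPlane := hz
  have hne : z - γ ≠ 0 := Complex.slitPlane_ne_zero hz'
  have hmem : Complex.log (z - γ) ∈ S := by
    rw [hS, Set.mem_ofPred_eq, Complex.log_im]
    exact ⟨Complex.neg_pi_lt_arg _, lt_of_le_of_ne (Complex.arg_le_pi _)
      (Complex.mem_slitPlane_iff_arg.1 hz').1⟩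
  have h1 := (hg _ hmem).hasDerivAt (hSo.mem_nhds hmem)
  have h2 : HasDerivAt (fun z : ℂ => Complex.log (z - γ)) (1 / (z - γ)) z :=
    ((hasDerivAt_id z).sub_const (γ : ℂ)).clog hz'
  have h3 := h1.comp z h2
  rw [Complex.exp_log hne, mul_assoc, mul_one_div_cancel hne, mul_one, add_sub_cancel] at h3
  exact h3

lemma norm_sub_le_of_norm_deriv_le_segment {F f : ℂ → ℂ} {M : ℝ} {z₁ z₂ : ℂ}
    (hF : ∀ z ∈ segment ℝ z₁ z₂, HasDerivAt F (f z) z)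
    (hM : ∀ z ∈ segment ℝ z₁ z₂, ‖f z‖ ≤ M) : ‖F z₂ - F z₁‖ ≤ M * ‖z₂ - z₁‖ :=
  (convex_segment z₁ z₂).norm_image_sub_le_of_norm_hasDerivWithin_le
    (fun z hz => (hF z hz).hasDerivWithinAt) hM (left_mem_segment ℝ z₁ z₂)
    (right_mem_segment ℝ z₁ z₂)

lemma mem_segment_vertical {x y₁ y₂ : ℝ} {z : ℂ}
    (hz : z ∈ segment ℝ ((x : ℂ) + y₁ * Complex.I) ((x : ℂ) + y₂ * Complex.I)) :
    z.re = x ∧ z.im ∈ Set.uIcc y₁ y₂ := by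
  obtain ⟨a, b, ha, hb, hab, rfl⟩ := hz
  constructor
  · simp
    rw [← add_mul, hab, one_mul]
  · rw [← segment_eq_uIcc]
    exact ⟨a, b, ha, hb, hab, by simp⟩

lemma mem_segment_horizontal {y x₁ x₂ : ℝ} {z : ℂ}
    (hz : z ∈ segment ℝ ((x₁ : ℂ) + y * Complex.I) ((x₂ : ℂ) + y * Complex.I)) :
    z.im = y ∧ z.re ∈ Set.uIcc x₁ x₂ := by
  obtain ⟨a, b, ha, hb, hab, rfl⟩ := hz
  constructor
  · simp
    rw [← add_mul, hab, one_mul]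
  · rw [← segment_eq_uIcc]
    exact ⟨a, b, ha, hb, hab, by simp⟩

/-- The fundamental theorem of calculus along a straight path in the complex plane. -/
lemma integral_comp_affine_eq_sub {F f : ℂ → ℂ} {U : Set ℂ} (hf : ContinuousOn f U)
    (hF : ∀ z ∈ U, HasDerivAt F (f z) z) (z₀ ω : ℂ) {x₁ x₂ : ℝ}
    (hU : ∀ t ∈ Set.uIcc x₁ x₂, z₀ + (t : ℂ) * ω ∈ U) :
    (∫ t in x₁..x₂, f (z₀ + (t : ℂ) * ω)) * ω = F (z₀ + (x₂ : ℂ) * ω) - F (z₀ + (x₁ : ℂ) * ω) := by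
  rw [← intervalIntegral.integral_mul_const]
  refine intervalIntegral.integral_eq_sub_of_hasDerivAt (f := fun t : ℝ => F (z₀ + (t : ℂ) * ω))
    (fun t ht => ?_) ?_
  · have h1 : HasDerivAt (fun t : ℝ => z₀ + (t : ℂ) * ω) ω t := by
      simpa using (((Complex.ofRealCLM.hasDerivAt (x := t)).mul_const ω).const_add z₀)
    exact (hF _ (hU t ht)).comp_of_eq t h1 rfl
  · refine ContinuousOn.intervalIntegrable ?_
    refine ContinuousOn.mul ?_ continuousOn_const
    exact hf.comp (by fun_prop) hU

/-- The three pieces of the loop telescope in terms of a primitive, and only its values at the far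
ends of the horizontal rays remain. In particular `c` drops out. -/
lemma tendsto_leftLoopIntegral {γ c φ₁ φ₂ : ℝ} (hc : γ < c) (hφ₁ : φ₁ < 0) (hφ₂ : 0 < φ₂)
    {F f : ℂ → ℂ} (hf : ContinuousOn f (slit γ)) (hF : ∀ z ∈ slit γ, HasDerivAt F (f z) z)
    (h₁ : IntegrableOn (fun t : ℝ => f (t + φ₁ * Complex.I)) (Set.Iic c))
    (h₂ : IntegrableOn (fun t : ℝ => f (t + φ₂ * Complex.I)) (Set.Iic c)) :
    Tendsto (fun t : ℝ => F (t + φ₂ * Complex.I) - F (t + φ₁ * Complex.I)) atBot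
      (𝓝 (leftLoopIntegral c φ₁ φ₂ f)) := by
  have hh : ∀ φ : ℝ, φ ≠ 0 → ∀ t : ℝ, ∫ x in t..c, f (x + φ * Complex.I) =
      F (c + φ * Complex.I) - F (t + φ * Complex.I) := by
    intro φ hφ t
    have := integral_comp_affine_eq_sub hf hF (φ * Complex.I) 1 (x₁ := t) (x₂ := c)
      (fun x _ => mem_slit.2 (Or.inr (by simpa using hφ)))
    simpa [add_comm] using this
  have hv : Complex.I * (∫ t in φ₁..φ₂, f (c + t * Complex.I)) =
      F (c + φ₂ * Complex.I) - F (c + φ₁ * Complex.I) := by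
    rw [mul_comm]
    exact integral_comp_affine_eq_sub hf hF c Complex.I
      (fun x _ => mem_slit.2 (Or.inl (by simpa using hc)))
  have l₁ := intervalIntegral_tendsto_integral_Iic c h₁ tendsto_id
  have l₂ := intervalIntegral_tendsto_integral_Iic c h₂ tendsto_id
  simp only [id, hh φ₁ hφ₁.ne, hh φ₂ hφ₂.ne'] at l₁ l₂
  rw [leftLoopIntegral, hv]
  refine ((l₁.add_const _).sub l₂).congr fun t => ?_
  ring

lemma tendsto_rightLoopIntegral {γ c φ₁ φ₂ : ℝ} (hc : γ < c) (hφ₁ : φ₁ < 0) (hφ₂ : 0 < φ₂)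
    {F f : ℂ → ℂ} (hf : ContinuousOn f (slit γ)) (hF : ∀ z ∈ slit γ, HasDerivAt F (f z) z)
    (h₁ : IntegrableOn (fun t : ℝ => f (t + φ₁ * Complex.I)) (Set.Ioi c))
    (h₂ : IntegrableOn (fun t : ℝ => f (t + φ₂ * Complex.I)) (Set.Ioi c)) :
    Tendsto (fun t : ℝ => F (t + φ₂ * Complex.I) - F (t + φ₁ * Complex.I)) atTop
      (𝓝 (rightLoopIntegral c φ₁ φ₂ f)) := by
  have hh : ∀ φ : ℝ, φ ≠ 0 → ∀ t : ℝ, ∫ x in c..t, f (x + φ * Complex.I) =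
      F (t + φ * Complex.I) - F (c + φ * Complex.I) := by
    intro φ hφ t
    have := integral_comp_affine_eq_sub hf hF (φ * Complex.I) 1 (x₁ := c) (x₂ := t)
      (fun x _ => mem_slit.2 (Or.inr (by simpa using hφ)))
    simpa [add_comm] using this
  have hv : Complex.I * (∫ t in φ₁..φ₂, f (c + t * Complex.I)) =
      F (c + φ₂ * Complex.I) - F (c + φ₁ * Complex.I) := by
    rw [mul_comm]
    exact integral_comp_affine_eq_sub hf hF c Complex.I
      (fun x _ => mem_slit.2 (Or.inl (by simpa using hc)))
  have l₁ := intervalIntegral_tendsto_integral_Ioi c h₁ tendsto_id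
  have l₂ := intervalIntegral_tendsto_integral_Ioi c h₂ tendsto_id
  simp only [id, hh φ₁ hφ₁.ne, hh φ₂ hφ₂.ne'] at l₁ l₂
  rw [rightLoopIntegral, hv, integral_Ici_eq_integral_Ioi, integral_Ici_eq_integral_Ioi]
  refine ((l₁.neg.add_const _).add l₂).congr fun t => ?_
  ring

/-! ### Polynomial growth against exponential decay -/

lemma tendsto_affine_pow_mul_exp_neg (α β : ℝ) (n : ℕ) {κ : ℝ} (hκ : 0 < κ) :
    Tendsto (fun r : ℝ => (α + β * r) ^ n * Real.exp (-(κ * r))) atTop (𝓝 0) := by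
  have h1 : (fun r : ℝ => α + β * r) =O[atTop] fun r : ℝ => r := by
    refine Asymptotics.IsBigO.add ?_ (Asymptotics.isBigO_const_mul_self _ _ _)
    exact (Asymptotics.isLittleO_const_id_atTop α).isBigO
  have h2 := (h1.pow n).trans_isLittleO (isLittleO_pow_exp_pos_mul_atTop n hκ)
  refine h2.tendsto_div_nhds_zero.congr fun r => ?_
  rw [Real.exp_neg, div_eq_mul_inv]

lemma exists_affine_pow_le_exp {α β : ℝ} (n : ℕ) {κ : ℝ} (hκ : 0 < κ) (hα : 0 ≤ α) (hβ : 0 ≤ β) :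
    ∃ C, 0 ≤ C ∧ ∀ r : ℝ, 0 ≤ r → (α + β * r) ^ n ≤ C * Real.exp (κ * r) := by
  refine ⟨n.factorial * ((β + 1) / κ) ^ n * Real.exp (α * κ / (β + 1)), by positivity,
    fun r hr => ?_⟩
  -- Dividing by `β + 1` instead of `β` also covers `β = 0` and keeps the exponential rate at most
  -- `κ`.
  have h := Real.pow_div_factorial_le_exp (κ / (β + 1) * (α + β * r)) (by positivity) n
  rw [div_le_iff₀ (by positivity), mul_pow] at h
  have h2 : Real.exp (κ / (β + 1) * (α + β * r)) ≤
      Real.exp (α * κ / (β + 1)) * Real.exp (κ * r) := by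
    rw [← Real.exp_add]
    refine Real.exp_le_exp.2 ?_
    have : κ / (β + 1) * (α + β * r) = α * κ / (β + 1) + κ * r * (β / (β + 1)) := by ring
    rw [this]
    have h3 : β / (β + 1) ≤ 1 := by rw [div_le_one (by positivity)]; linarith
    have h4 : κ * r * (β / (β + 1)) ≤ κ * r * 1 := by gcongr
    linarith
  have hne : (κ / (β + 1)) ^ n * ((β + 1) / κ) ^ n = 1 := by
    rw [← mul_pow]
    have : κ / (β + 1) * ((β + 1) / κ) = 1 := by field_simp
    rw [this, one_pow]
  calc (α + β * r) ^ n = (κ / (β + 1)) ^ n * (α + β * r) ^ n * ((β + 1) / κ) ^ n := by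
        linear_combination (-(α + β * r) ^ n) * hne
    _ ≤ Real.exp (κ / (β + 1) * (α + β * r)) * n.factorial * ((β + 1) / κ) ^ n := by gcongr
    _ ≤ Real.exp (α * κ / (β + 1)) * Real.exp (κ * r) * n.factorial * ((β + 1) / κ) ^ n := by
        gcongr
    _ = _ := by ring

/-- Integrability on a half-line of a function with polynomial growth times `exp (-κ t)`. -/
lemma integrableOn_Ioi_of_norm_le_pow_mul_exp {g : ℝ → ℂ} {c κ C α : ℝ} {n : ℕ} (hκ : 0 < κ)
    (hα : 0 ≤ α) (hg : ContinuousOn g (Set.Ioi c)) (hC : 0 ≤ C)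
    (hb : ∀ t ∈ Set.Ioi c, ‖g t‖ ≤ C * (α + |t|) ^ n * Real.exp (-(κ * t))) :
    IntegrableOn g (Set.Ioi c) := by
  obtain ⟨D, hD0, hD⟩ := exists_affine_pow_le_exp (α := α + 2 * |c|) (β := 1) n (half_pos hκ)
    (by positivity) zero_le_one
  have hi : IntegrableOn (fun t => C * D * Real.exp (κ / 2 * |c|) * Real.exp (-(κ / 2) * t))
      (Set.Ioi c) := (integrableOn_exp_mul_Ioi (by linarith) c).const_mul _
  refine Integrable.mono' hi (hg.aestronglyMeasurable measurableSet_Ioi) ?_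
  refine (ae_restrict_iff' measurableSet_Ioi).2 (Eventually.of_forall fun t ht => ?_)
  refine (hb t ht).trans ?_
  have ht' : c < t := ht
  have hc := neg_abs_le c
  have hc' := abs_nonneg c
  have h1 : α + |t| ≤ α + 2 * |c| + 1 * (t + |c|) := by
    have : |t| ≤ t + 2 * |c| := abs_le.2 ⟨by linarith, by linarith⟩
    linarith
  have h2 := hD (t + |c|) (by linarith)
  have h3 : (α + |t|) ^ n ≤ D * Real.exp (κ / 2 * (t + |c|)) :=
    (pow_le_pow_left₀ (by positivity) h1 n).trans h2
  calc C * (α + |t|) ^ n * Real.exp (-(κ * t))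
      ≤ C * (D * Real.exp (κ / 2 * (t + |c|))) * Real.exp (-(κ * t)) := by gcongr
    _ = C * D * (Real.exp (κ / 2 * (t + |c|)) * Real.exp (-(κ * t))) := by ring
    _ = C * D * (Real.exp (κ / 2 * |c|) * Real.exp (-(κ / 2) * t)) := by
        rw [← Real.exp_add, ← Real.exp_add]; ring_nf
    _ = _ := by ring

lemma norm_exp_ofReal_mul (κ : ℝ) (z : ℂ) :
    ‖Complex.exp (κ * z)‖ = Real.exp (κ * z.re) := by
  rw [Complex.norm_exp, Complex.re_ofReal_mul]

lemma norm_ofReal_add_mul_I_le (t φ : ℝ) : ‖(t : ℂ) + φ * Complex.I‖ ≤ |t| + |φ| := by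
  simpa using norm_add_le (t : ℂ) (φ * Complex.I)

/-- The loop integral to the right vanishes. -/
theorem rightLoopIntegral_eq_zero {γ c φ₁ φ₂ κ C : ℝ} {n : ℕ} (hc : γ < c) (hφ₁ : φ₁ < 0)
    (hφ₂ : 0 < φ₂) (hκ : 0 < κ) (hC : 0 ≤ C) {g : ℂ → ℂ} (hg : DifferentiableOn ℂ g (slit γ))
    (hb : ∀ z : ℂ, c ≤ z.re → ‖g z‖ ≤ C * (1 + ‖z‖) ^ n) :
    rightLoopIntegral c φ₁ φ₂ (fun z => g z * Complex.exp (((-κ : ℝ) : ℂ) * z)) = 0 := by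
  have hd : DifferentiableOn ℂ (fun z => g z * Complex.exp (((-κ : ℝ) : ℂ) * z)) (slit γ) :=
    hg.mul (by fun_prop)
  obtain ⟨F, hF⟩ := exists_primitive_slit hd
  have hint : ∀ φ : ℝ, φ ≠ 0 → IntegrableOn (fun t : ℝ => g (t + φ * Complex.I) *
      Complex.exp (((-κ : ℝ) : ℂ) * (t + φ * Complex.I))) (Set.Ioi c) := by
    intro φ hφ
    refine integrableOn_Ioi_of_norm_le_pow_mul_exp (C := C) (α := 1 + |φ|) (n := n) hκ
      (by positivity) ?_ hC fun t ht => ?_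
    · exact hd.continuousOn.comp (by fun_prop) fun t _ => mem_slit.2 (Or.inr (by simpa using hφ))
    · have ht' : c < t := ht
      rw [norm_mul, norm_exp_ofReal_mul]
      simp only [Complex.add_re, Complex.ofReal_re, Complex.re_ofReal_mul, Complex.I_re, mul_zero,
        add_zero, neg_mul]
      gcongr
      refine (hb _ (by simpa using ht'.le)).trans ?_
      gcongr C * ?_ ^ n
      linarith [norm_ofReal_add_mul_I_le t φ]
  -- The far ends are joined by a vertical segment of fixed length `φ₂ - φ₁`, on which the integrand
  -- is at most a power of `t` times `exp(-κ t)`.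
  refine tendsto_nhds_unique (tendsto_rightLoopIntegral hc hφ₁ hφ₂ hd.continuousOn hF
    (hint φ₁ hφ₁.ne) (hint φ₂ hφ₂.ne')) ?_
  refine squeeze_zero_norm' (a := fun t : ℝ => C * ((1 + |φ₁| + |φ₂| + 1 * t) ^ n *
    Real.exp (-(κ * t))) * (φ₂ - φ₁)) ?_ ?_
  · filter_upwards [eventually_ge_atTop 0, eventually_gt_atTop c] with t ht0 htc
    have h := norm_sub_le_of_norm_deriv_le_segment (F := F)
      (f := fun z => g z * Complex.exp (((-κ : ℝ) : ℂ) * z)) (z₁ := t + φ₁ * Complex.I)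
      (z₂ := t + φ₂ * Complex.I) (M := C * ((1 + |φ₁| + |φ₂| + 1 * t) ^ n * Real.exp (-(κ * t))))
      (fun z hz => hF z (mem_slit.2 (Or.inl (by
        rw [(mem_segment_vertical hz).1]; linarith)))) (fun z hz => ?_)
    · refine h.trans (le_of_eq ?_)
      congr 1
      rw [add_sub_add_left_eq_sub, ← sub_mul, norm_mul, Complex.norm_I, mul_one,
        ← Complex.ofReal_sub, Complex.norm_real, Real.norm_eq_abs, abs_of_pos (by linarith)]
    · obtain ⟨hre, him⟩ := mem_segment_vertical hz
      rw [norm_mul, norm_exp_ofReal_mul, hre, neg_mul, ← mul_assoc]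
      gcongr
      refine (hb z (by linarith)).trans ?_
      gcongr C * ?_ ^ n
      have h1 := Complex.norm_le_abs_re_add_abs_im z
      rw [hre, abs_of_nonneg ht0] at h1
      rw [Set.uIcc_of_le (by linarith)] at him
      have h2 : |z.im| ≤ |φ₁| + |φ₂| := by
        refine abs_le.2 ⟨?_, ?_⟩
        · linarith [him.1, neg_abs_le φ₁, abs_nonneg φ₂]
        · linarith [him.2, le_abs_self φ₂, abs_nonneg φ₁]
      linarith
  · have := ((tendsto_affine_pow_mul_exp_neg (1 + |φ₁| + |φ₂|) 1 n hκ).const_mul C).mul_const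
      (φ₂ - φ₁)
    simpa using this

/-! ### From the left loop to a wedge -/

/-- The direction `-1 + 2εi`; the wedge consists of the rays with `ε = ±1`. -/
def dir (ε : ℝ) : ℂ := -1 + ((2 * ε : ℝ) : ℂ) * Complex.I

lemma add_mul_dir (c r ε : ℝ) :
    (c : ℂ) + (r : ℂ) * dir ε = ((c - r : ℝ) : ℂ) + ((2 * ε * r : ℝ) : ℂ) * Complex.I := by
  rw [dir]; push_cast; ring

lemma add_mul_dir_re (c r ε : ℝ) : ((c : ℂ) + (r : ℂ) * dir ε).re = c - r := by
  rw [add_mul_dir]; simp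

lemma add_mul_dir_im (c r ε : ℝ) : ((c : ℂ) + (r : ℂ) * dir ε).im = 2 * ε * r := by
  rw [add_mul_dir]; simp

lemma add_mul_dir_mem_rightRegion {c r ε : ℝ} (hε : |ε| = 1) (hr : 0 ≤ r) :
    (c : ℂ) + (r : ℂ) * dir ε ∈ rightRegion c := by
  change c - |((c : ℂ) + (r : ℂ) * dir ε).im| / 2 ≤ ((c : ℂ) + (r : ℂ) * dir ε).re
  rw [add_mul_dir_re, add_mul_dir_im, abs_mul, abs_mul, hε, abs_two, abs_of_nonneg hr]
  linarith

/-- On the line `Re z = c - r` the factor `exp(κ z)` has size `exp(κ(c - r))`, which beats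
polynomial growth along a segment of length `O(r)`. Moving vertically is thus free in the limit; the
exponent `n + 1` absorbs the length. -/
lemma tendsto_sub_vertical_left {F g : ℂ → ℂ} {c κ C α : ℝ} {n : ℕ} (hκ : 0 < κ) (hC : 0 ≤ C)
    {y₁ y₂ : ℝ → ℝ} (hy₁ : ∀ r, 0 ≤ r → |y₁ r| ≤ α + 2 * r) (hy₂ : ∀ r, 0 ≤ r → |y₂ r| ≤ α + 2 * r)
    (h : ∀ᶠ r : ℝ in atTop, ∀ z : ℂ, z.re = c - r → z.im ∈ Set.uIcc (y₁ r) (y₂ r) →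
      HasDerivAt F (g z * Complex.exp (κ * z)) z ∧ ‖g z‖ ≤ C * (1 + ‖z‖) ^ n) :
    Tendsto (fun r : ℝ => F (((c - r : ℝ) : ℂ) + y₂ r * Complex.I) -
      F (((c - r : ℝ) : ℂ) + y₁ r * Complex.I)) atTop (𝓝 0) := by
  have hα : 0 ≤ α := by simpa using (abs_nonneg _).trans (hy₁ 0 le_rfl)
  refine squeeze_zero_norm' (a := fun r : ℝ => C * Real.exp (κ * c) *
    ((1 + |c| + 2 * α + 4 * r) ^ (n + 1) * Real.exp (-(κ * r)))) ?_ ?_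
  · filter_upwards [h, eventually_ge_atTop 0] with r hr hr0
    have hc := abs_nonneg c
    have key := norm_sub_le_of_norm_deriv_le_segment (F := F)
      (f := fun z => g z * Complex.exp (κ * z)) (z₁ := ((c - r : ℝ) : ℂ) + y₁ r * Complex.I)
      (z₂ := ((c - r : ℝ) : ℂ) + y₂ r * Complex.I)
      (M := C * (1 + |c| + 2 * α + 4 * r) ^ n * Real.exp (κ * (c - r)))
      (fun z hz => (hr z (mem_segment_vertical hz).1 (mem_segment_vertical hz).2).1)
      (fun z hz => ?_)
    · refine key.trans ?_
      have hlen : ‖((c - r : ℝ) : ℂ) + y₂ r * Complex.I -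
          (((c - r : ℝ) : ℂ) + y₁ r * Complex.I)‖ ≤ 1 + |c| + 2 * α + 4 * r := by
        rw [add_sub_add_left_eq_sub, ← sub_mul, norm_mul, Complex.norm_I, mul_one,
          ← Complex.ofReal_sub, Complex.norm_real, Real.norm_eq_abs]
        have := abs_sub (y₂ r) (y₁ r)
        linarith [hy₁ r hr0, hy₂ r hr0]
      calc _ ≤ C * (1 + |c| + 2 * α + 4 * r) ^ n * Real.exp (κ * (c - r)) *
            (1 + |c| + 2 * α + 4 * r) := by gcongr
        _ = _ := by
            rw [show κ * (c - r) = κ * c + -(κ * r) by ring, Real.exp_add]; ring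
    · obtain ⟨hre, him⟩ := mem_segment_vertical hz
      rw [norm_mul, norm_exp_ofReal_mul, hre]
      gcongr
      refine (hr z hre him).2.trans ?_
      gcongr C * ?_ ^ n
      have h1 := Complex.norm_le_abs_re_add_abs_im z
      have h2 : |z.re| ≤ |c| + r := by
        rw [hre]
        have := abs_sub c r
        rwa [abs_of_nonneg hr0] at this
      have h3 : |z.im| ≤ α + 2 * r := by
        have a1 := abs_le.1 (hy₁ r hr0)
        have a2 := abs_le.1 (hy₂ r hr0)
        refine abs_le.2 ⟨(le_min a1.1 a2.1).trans him.1, him.2.trans (max_le a1.2 a2.2)⟩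
      linarith
  · have := (tendsto_affine_pow_mul_exp_neg (1 + |c| + 2 * α) 4 (n + 1) hκ).const_mul
      (C * Real.exp (κ * c))
    simpa using this

lemma integrableOn_ray {γ c κ C ε : ℝ} (hc : γ < c) (hε : |ε| = 1) (hκ : 0 < κ) (hC : 0 ≤ C)
    {K : ℂ → ℂ} (hK : DifferentiableOn ℂ K (slit γ)) (hb : ∀ z ∈ rightRegion c, ‖K z‖ ≤ C) :
    IntegrableOn (fun r : ℝ => K (c + r * dir ε) * Complex.exp (κ * (c + r * dir ε)))
      (Set.Ioi 0) := by
  refine integrableOn_Ioi_of_norm_le_pow_mul_exp (C := C * Real.exp (κ * c)) (α := 0) (n := 0) hκ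
    le_rfl ?_ (by positivity) fun r hr => ?_
  · refine ContinuousOn.mul ?_ (by fun_prop)
    exact hK.continuousOn.comp (by fun_prop) fun r hr =>
      rightRegion_subset_slit hc (add_mul_dir_mem_rightRegion hε (le_of_lt hr))
  · rw [norm_mul, norm_exp_ofReal_mul, add_mul_dir_re, pow_zero, mul_one, mul_assoc,
      ← Real.exp_add]
    have := hb _ (add_mul_dir_mem_rightRegion hε (le_of_lt hr))
    rw [mul_sub, ← sub_eq_add_neg]
    gcongr

/-- The set `U` is left free: it is the slit plane when the loop is opened, and the part of
`rightRegion c` left of `Re s` in Cauchy's formula. -/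
lemma tendsto_ray {c ε : ℝ} {U : Set ℂ} {F f : ℂ → ℂ} (hf : ContinuousOn f U)
    (hF : ∀ z ∈ U, HasDerivAt F (f z) z) (hU : ∀ r : ℝ, 0 ≤ r → (c : ℂ) + r * dir ε ∈ U)
    (hi : IntegrableOn (fun r : ℝ => f (c + r * dir ε)) (Set.Ioi 0)) :
    Tendsto (fun r : ℝ => F (c + r * dir ε)) atTop
      (𝓝 ((∫ r in Set.Ioi (0 : ℝ), f (c + r * dir ε)) * dir ε + F c)) := by
  have l := ((intervalIntegral_tendsto_integral_Ioi 0 hi tendsto_id).mul_const (dir ε)).add_const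
    (F c)
  refine l.congr' ?_
  filter_upwards [eventually_ge_atTop 0] with r hr
  have := integral_comp_affine_eq_sub hf hF c (dir ε) (x₁ := 0) (x₂ := r) (fun t ht => by
    rw [Set.uIcc_of_le hr] at ht
    exact hU t ht.1)
  simp only [id]
  rw [this]
  simp

/-- The integral over the left loop equals the integral over the wedge with vertex `c'`, and the
entire part `P` of the integrand does not contribute. -/
theorem leftLoopIntegral_eq_wedge {γ c c' φ₁ φ₂ κ C : ℝ} {n : ℕ} (hc : γ < c) (hc' : γ < c')
    (hφ₁ : φ₁ < 0) (hφ₂ : 0 < φ₂) (hκ : 0 < κ) (hC : 0 ≤ C) {K P : ℂ → ℂ}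
    (hK : DifferentiableOn ℂ K (slit γ)) (hP : Differentiable ℂ P)
    (hKb : ∀ z ∈ rightRegion c', ‖K z‖ ≤ C) (hPb : ∀ z, ‖P z‖ ≤ C * (1 + ‖z‖) ^ n)
    (hb : ∀ z : ℂ, z.re ≤ c → min (-φ₁) φ₂ ≤ |z.im| → ‖K z + P z‖ ≤ C * (1 + ‖z‖) ^ n) :
    leftLoopIntegral c φ₁ φ₂ (fun z => (K z + P z) * Complex.exp (κ * z)) =
      (∫ r in Set.Ioi (0 : ℝ), K (c' + r * dir 1) * Complex.exp (κ * (c' + r * dir 1))) * dir 1 -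
      (∫ r in Set.Ioi (0 : ℝ), K (c' + r * dir (-1)) * Complex.exp (κ * (c' + r * dir (-1)))) *
        dir (-1) := by
  have hKd : DifferentiableOn ℂ (fun z => K z * Complex.exp (κ * z)) (slit γ) :=
    hK.mul (by fun_prop)
  have hPd : Differentiable ℂ (fun z => P z * Complex.exp (κ * z)) := by fun_prop
  have hd : DifferentiableOn ℂ (fun z => (K z + P z) * Complex.exp (κ * z)) (slit γ) :=
    (hK.add hP.differentiableOn).mul (by fun_prop)
  obtain ⟨F, hF⟩ := exists_primitive_slit hKd
  -- Having a primitive on the whole plane is what eliminates `P`: the ends of the loop may be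
  -- joined across the slit.
  obtain ⟨E, hE⟩ := hPd.isExactOn_univ
  have hFE : ∀ z ∈ slit γ, HasDerivAt (fun z => F z + E z)
      ((K z + P z) * Complex.exp (κ * z)) z := by
    intro z hz
    rw [add_mul]
    exact (hF z hz).add (hE z (Set.mem_univ z))
  have hint : ∀ φ : ℝ, φ ≠ 0 → min (-φ₁) φ₂ ≤ |φ| → IntegrableOn (fun t : ℝ =>
      (K (t + φ * Complex.I) + P (t + φ * Complex.I)) *
        Complex.exp (κ * (t + φ * Complex.I))) (Set.Iic c) := by
    intro φ hφ hφ'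
    rw [integrableOn_Iic_iff_integrableOn_Iio]
    have h1 : IntegrableOn (fun t : ℝ =>
      (K ((-t : ℝ) + φ * Complex.I) + P ((-t : ℝ) + φ * Complex.I)) *
        Complex.exp (κ * ((-t : ℝ) + φ * Complex.I))) (Set.Ioi (-c)) := by
      refine integrableOn_Ioi_of_norm_le_pow_mul_exp (C := C) (α := 1 + |φ|) (n := n) hκ
        (by positivity) ?_ hC fun t ht => ?_
      · exact hd.continuousOn.comp (by fun_prop)
          fun t _ => mem_slit.2 (Or.inr (by simpa using hφ))
      · have ht' : -c < t := ht
        rw [norm_mul, norm_exp_ofReal_mul]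
        simp only [Complex.add_re, Complex.ofReal_re, Complex.re_ofReal_mul, Complex.I_re,
          mul_zero, add_zero, mul_neg]
        gcongr
        refine (hb _ (by simpa using (by linarith : -t ≤ c)) (by simpa using hφ')).trans ?_
        gcongr C * ?_ ^ n
        have := norm_ofReal_add_mul_I_le (-t) φ
        rw [abs_neg] at this
        linarith
    have h2 := h1.comp_neg_Iio
    simpa using h2
  have habs₁ : min (-φ₁) φ₂ ≤ |φ₁| := (min_le_left _ _).trans (neg_le_abs _)
  have habs₂ : min (-φ₁) φ₂ ≤ |φ₂| := (min_le_right _ _).trans (le_abs_self _)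
  have hmin : 0 < min (-φ₁) φ₂ := lt_min (by linarith) hφ₂
  have hloop := tendsto_leftLoopIntegral hc hφ₁ hφ₂ hd.continuousOn hFE
    (hint φ₁ hφ₁.ne habs₁) (hint φ₂ hφ₂.ne' habs₂)
  -- The parameter becomes `t = c' - r`, which puts the ends of the loop and the points of the wedge
  -- on one vertical line.
  have hloop' := hloop.comp (tendsto_atBot_add_const_left atTop c' tendsto_neg_atTop_atBot)
  have hray : ∀ ε : ℝ, |ε| = 1 → Tendsto (fun r : ℝ => F (c' + r * dir ε)) atTop
      (𝓝 ((∫ r in Set.Ioi (0 : ℝ), K (c' + r * dir ε) * Complex.exp (κ * (c' + r * dir ε))) *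
        dir ε + F c')) := fun ε hε => by
    exact tendsto_ray hKd.continuousOn hF (fun r hr =>
      rightRegion_subset_slit hc' (add_mul_dir_mem_rightRegion hε hr))
      (integrableOn_ray hc' hε hκ hC hK hKb)
  have hKleft : ∀ z : ℂ, z.re ≤ c → min (-φ₁) φ₂ ≤ |z.im| →
      ‖K z‖ ≤ (2 * C) * (1 + ‖z‖) ^ n := by
    intro z h1 h2
    have h3 := norm_sub_le (K z + P z) (P z)
    rw [add_sub_cancel_right] at h3
    have := hb z h1 h2
    have := hPb z
    linarith
  have hvE : Tendsto (fun r : ℝ => E (((c' - r : ℝ) : ℂ) + φ₂ * Complex.I) -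
      E (((c' - r : ℝ) : ℂ) + φ₁ * Complex.I)) atTop (𝓝 0) := by
    refine tendsto_sub_vertical_left (g := P) (α := |φ₁| + |φ₂|) (n := n) hκ hC
      (y₁ := fun _ => φ₁) (y₂ := fun _ => φ₂) (fun r hr => ?_) (fun r hr => ?_) ?_
    · linarith [abs_nonneg φ₂]
    · linarith [abs_nonneg φ₁]
    · exact Eventually.of_forall fun r z _ _ => ⟨hE z (Set.mem_univ z), hPb z⟩
  -- The segment from the wedge to the horizontal branch stays on one side of the real axis, at
  -- distance at least `min (-φ₁) φ₂`. There `F` is a primitive and the bound on the left applies.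
  have hvF : ∀ ε φ : ℝ, |ε| = 1 → 0 < ε * φ → min (-φ₁) φ₂ ≤ |φ| →
      Tendsto (fun r : ℝ => F (((c' - r : ℝ) : ℂ) + φ * Complex.I) -
      F (((c' - r : ℝ) : ℂ) + (2 * ε * r : ℝ) * Complex.I)) atTop (𝓝 0) := by
    intro ε φ hε hεφ hφ
    refine tendsto_sub_vertical_left (g := K) (α := |φ|) (n := n) (C := 2 * C) hκ (by positivity)
      (y₁ := fun r => 2 * ε * r) (y₂ := fun _ => φ) (fun r hr => ?_) (fun r hr => ?_) ?_
    · rw [abs_mul, abs_mul, hε, abs_two, abs_of_nonneg hr]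
      linarith [abs_nonneg φ]
    · linarith
    · filter_upwards [eventually_ge_atTop (c' - c), eventually_ge_atTop |φ|] with r hr1 hr2 z hre
        him
      have hle : |φ| ≤ |z.im| := by
        rcases (abs_eq zero_le_one).1 hε with rfl | rfl
        · have hφ0 : 0 < φ := by linarith
          rw [abs_of_pos hφ0] at hr2 ⊢
          rw [Set.uIcc_of_ge (by linarith)] at him
          exact him.1.trans (le_abs_self _)
        · have hφ0 : φ < 0 := by linarith
          rw [abs_of_neg hφ0] at hr2 ⊢
          rw [Set.uIcc_of_le (by linarith)] at him
          exact (neg_le_neg him.2).trans (neg_le_abs _)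
      refine ⟨hF z (mem_slit.2 (Or.inr ?_)), hKleft z (by linarith) (hφ.trans hle)⟩
      exact abs_pos.1 (hmin.trans_le (hφ.trans hle))
  have hlim := (hvE.add (hvF 1 φ₂ (by simp) (by simpa using hφ₂) habs₂)).sub
    (hvF (-1) φ₁ (by simp) (by linarith) habs₁)
  have hlim2 := hlim.add ((hray 1 (by simp)).sub (hray (-1) (by simp)))
  refine tendsto_nhds_unique hloop' ?_
  convert! hlim2 using 2
  · rename_i r
    simp only [add_mul_dir, Function.comp_apply]
    rw [show c' + -r = c' - r by ring]
    ring
  · ring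

/-! ### Cauchy's formula for the wedge -/

lemma le_norm_add_mul_dir {c r ε : ℝ} (hε : |ε| = 1) (hr : 0 ≤ r) :
    r ≤ ‖(c : ℂ) + r * dir ε‖ := by
  have h := Complex.abs_im_le_norm ((c : ℂ) + r * dir ε)
  rw [add_mul_dir_im, abs_mul, abs_mul, hε, abs_two, abs_of_nonneg hr] at h
  linarith

/-- One factor `1/r` comes from the decay of `K`, the other from `1/(s - z)`, whose denominator has
real part `σ - c + r` if `Re s = σ`. -/
lemma ray_weight_le {C c σ ε r : ℝ} (hC : 0 ≤ C) (hε : |ε| = 1) (hr : 0 ≤ r) (hσ : c < σ) :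
    C / (1 + ‖(c : ℂ) + r * dir ε‖) / (σ - c + r) ≤
      C / min (σ - c) 1 * (1 + r ^ 2)⁻¹ := by
  have hη : 0 < min (σ - c) 1 := lt_min (by linarith) one_pos
  have h1 : min (σ - c) 1 ≤ σ - c := min_le_left _ _
  have h2 : min (σ - c) 1 ≤ 1 := min_le_right _ _
  have h3 := le_norm_add_mul_dir (c := c) hε hr
  rw [div_div, ← div_eq_mul_inv, div_div]
  refine div_le_div_of_nonneg_left hC (by positivity) ?_
  calc min (σ - c) 1 * (1 + r ^ 2) ≤ (1 + r) * (min (σ - c) 1 + min (σ - c) 1 * r) := by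
        nlinarith [mul_nonneg hη.le hr]
    _ ≤ (1 + ‖(c : ℂ) + r * dir ε‖) * (σ - c + r) := by
        gcongr
        nlinarith

lemma integrableOn_ray_div {γ c C ε : ℝ} (hc : γ < c) (hε : |ε| = 1) (hC : 0 ≤ C)
    {K : ℂ → ℂ} (hK : DifferentiableOn ℂ K (slit γ))
    (hb : ∀ z ∈ rightRegion c, ‖K z‖ ≤ C / (1 + ‖z‖)) {s : ℂ} (hs : c < s.re) :
    IntegrableOn (fun r : ℝ => K (c + r * dir ε) / (s - (c + r * dir ε))) (Set.Ioi 0) := by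
  have hre : ∀ r : ℝ, (s - (c + r * dir ε)).re = s.re - c + r := fun r => by
    rw [Complex.sub_re, add_mul_dir_re]; ring
  refine Integrable.mono' ((integrable_inv_one_add_sq.const_mul (C / min (s.re - c) 1)).restrict)
    (ContinuousOn.aestronglyMeasurable ?_ measurableSet_Ioi) ?_
  · refine ContinuousOn.div ?_ (by fun_prop) fun r hr h => ?_
    · exact hK.continuousOn.comp (by fun_prop) fun r hr =>
        rightRegion_subset_slit hc (add_mul_dir_mem_rightRegion hε (le_of_lt hr))
    · have hr' : 0 < r := hr
      have h1 := hre r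
      rw [h, Complex.zero_re] at h1
      linarith
  · refine (ae_restrict_iff' measurableSet_Ioi).2 (Eventually.of_forall fun r hr => ?_)
    have hr' : 0 < r := hr
    refine le_trans ?_ (ray_weight_le hC hε hr'.le hs)
    rw [norm_div]
    have h1 := hb _ (add_mul_dir_mem_rightRegion (c := c) hε hr'.le)
    have h2 : s.re - c + r ≤ ‖s - (c + r * dir ε)‖ := by
      rw [← hre]; exact Complex.re_le_norm _
    have h3 : 0 < s.re - c + r := by linarith
    gcongr

/-- Cauchy's integral formula for the wedge. -/
theorem wedge_integral_eq {γ c C : ℝ} (hc : γ < c) (hC : 0 ≤ C)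
    {K : ℂ → ℂ} (hK : DifferentiableOn ℂ K (slit γ))
    (hb : ∀ z ∈ rightRegion c, ‖K z‖ ≤ C / (1 + ‖z‖)) {s : ℂ} (hs : c < s.re) :
    (∫ r in Set.Ioi (0 : ℝ), K (c + r * dir 1) / (s - (c + r * dir 1))) * dir 1 -
      (∫ r in Set.Ioi (0 : ℝ), K (c + r * dir (-1)) / (s - (c + r * dir (-1)))) * dir (-1) =
      2 * Real.pi * Complex.I * K s := by
  have hsmem : s ∈ slit γ := mem_slit.2 (Or.inl (hc.trans hs))
  have hdd : DifferentiableOn ℂ (dslope K s) (slit γ) :=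
    (Complex.differentiableOn_dslope ((isOpen_slit γ).mem_nhds hsmem)).2 hK
  -- `dslope K s` removes the singularity at `s`; what remains is a multiple of `1/(z - s)`. Its
  -- primitive is `log(s - z)` on the rays, left of `s`, and `log(z - s)` on the closing path around
  -- the right of `s`.
  obtain ⟨F, hF⟩ := exists_primitive_slit hdd
  have hslope : ∀ z, z ≠ s → dslope K s z = (K z - K s) / (z - s) := by
    intro z hz
    rw [dslope_of_ne K hz, slope_def_field]
  have hΨ : ∀ z ∈ slit γ, s - z ∈ Complex.slitPlane →
      HasDerivAt (fun z => -F z - K s * Complex.log (s - z)) (K z / (s - z)) z := by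
    intro z hz hzs
    have hne : s - z ≠ 0 := Complex.slitPlane_ne_zero hzs
    have h1 := (hF z hz).neg.sub ((((hasDerivAt_id z).const_sub s).clog hzs).const_mul (K s))
    convert! h1 using 1
    rw [hslope z (by rintro rfl; simp at hne)]
    have hne' : z - s ≠ 0 := by rw [← neg_sub]; exact neg_ne_zero.2 hne
    rw [show s - z = -(z - s) by ring, id]
    field_simp
    ring
  have hΘ : ∀ z ∈ slit γ, z - s ∈ Complex.slitPlane →
      HasDerivAt (fun z => -F z - K s * Complex.log (z - s)) (K z / (s - z)) z := by
    intro z hz hzs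
    have hne : z - s ≠ 0 := Complex.slitPlane_ne_zero hzs
    have h1 := (hF z hz).neg.sub ((((hasDerivAt_id z).sub_const s).clog hzs).const_mul (K s))
    convert! h1 using 1
    rw [hslope z (by rintro rfl; simp at hne)]
    rw [show s - z = -(z - s) by ring, id]
    field_simp
    ring
  have hcont : ContinuousOn (fun z => K z / (s - z)) (rightRegion c ∩ {z | z ≠ s}) :=
    (hK.continuousOn.mono (Set.inter_subset_left.trans (rightRegion_subset_slit hc))).div
      (by fun_prop) fun z hz => sub_ne_zero.2 (Ne.symm hz.2)
  have hray : ∀ ε : ℝ, |ε| = 1 → Tendsto (fun r : ℝ =>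
      (fun z => -F z - K s * Complex.log (s - z)) (c + r * dir ε)) atTop
      (𝓝 ((∫ r in Set.Ioi (0 : ℝ), K (c + r * dir ε) / (s - (c + r * dir ε))) * dir ε +
        (fun z => -F z - K s * Complex.log (s - z)) c)) := by
    intro ε hε
    refine tendsto_ray (F := fun z => -F z - K s * Complex.log (s - z))
      (U := rightRegion c ∩ {z | z.re < s.re}) (hcont.mono ?_) ?_ ?_
      (integrableOn_ray_div hc hε hC hK hb hs)
    · rintro z ⟨hz1, hz2⟩
      have hz2' : z.re < s.re := hz2
      exact ⟨hz1, by rintro rfl; exact lt_irrefl _ hz2'⟩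
    · rintro z ⟨hz1, hz2⟩
      refine hΨ z (rightRegion_subset_slit hc hz1) (Complex.mem_slitPlane_iff.2 (Or.inl ?_))
      have hz2' : z.re < s.re := hz2
      rw [Complex.sub_re]
      linarith
    · intro r hr
      refine ⟨add_mul_dir_mem_rightRegion hε hr, ?_⟩
      change ((c : ℂ) + r * dir ε).re < s.re
      rw [add_mul_dir_re]
      linarith
  -- The two branches differ by `πi` at the upper end and by `-πi` at the lower end, which together
  -- produce the factor `2πi`.
  have hlog : ∀ ε : ℝ, |ε| = 1 → ∀ᶠ r : ℝ in atTop,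
      Complex.log (c + r * dir ε - s) - Complex.log (s - (c + r * dir ε)) =
        ε * Real.pi * Complex.I := by
    intro ε hε
    filter_upwards [eventually_gt_atTop |s.im|] with r hr
    have hr0 := (abs_nonneg s.im).trans_lt hr
    have him : ((c : ℂ) + r * dir ε - s).im = 2 * ε * r - s.im := by
      rw [Complex.sub_im, add_mul_dir_im]
    have hneg : s - (c + r * dir ε) = -(c + r * dir ε - s) := by ring
    rw [hneg]
    apply Complex.ext
    · rw [Complex.sub_re, Complex.log_re, Complex.log_re, norm_neg]
      simp
    · rw [Complex.sub_im, Complex.log_im, Complex.log_im]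
      rcases (abs_eq zero_le_one).1 hε with rfl | rfl
      · rw [Complex.arg_neg_eq_arg_sub_pi_of_im_pos (by
          rw [him]; linarith [le_abs_self s.im])]
        simp
      · rw [Complex.arg_neg_eq_arg_add_pi_of_im_neg (by
          rw [him]; linarith [neg_abs_le s.im])]
        simp
  have hbig : Tendsto (fun r : ℝ => (fun z => -F z - K s * Complex.log (z - s)) (c + r * dir 1) -
      (fun z => -F z - K s * Complex.log (z - s)) (c + r * dir (-1))) atTop (𝓝 0) := by
    -- The ends of the rays are joined by three sides of a box through `r ± 2ri`, of total length at
    -- most `3r + 4r + 3r`, on which the integrand is at most `2C/r²`.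
    refine squeeze_zero_norm' (a := fun r : ℝ => 20 * C * r⁻¹) ?_ ?_
    · filter_upwards [eventually_gt_atTop (2 * ‖s‖), eventually_gt_atTop |c|,
        eventually_gt_atTop 0] with r hrs hrc hr0
      set Θ : ℂ → ℂ := fun z => -F z - K s * Complex.log (z - s) with hΘdef
      have hsn : ‖s‖ < r := by linarith [norm_nonneg s]
      have hsre := (abs_le.1 (Complex.abs_re_le_norm s))
      have hsim := (abs_le.1 (Complex.abs_im_le_norm s))
      have hc1 := le_abs_self c
      have hc2 := neg_abs_le c
      have hbound : ∀ z ∈ rightRegion c, r ≤ ‖z‖ → ‖K z / (s - z)‖ ≤ 2 * C * r⁻¹ * r⁻¹ := by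
        intro z hz hzr
        have h1 := hb z hz
        have h2 : r / 2 ≤ ‖s - z‖ := by
          have := norm_sub_norm_le z s
          rw [norm_sub_rev] at this
          linarith
        rw [norm_div]
        calc ‖K z‖ / ‖s - z‖ ≤ (C / (1 + ‖z‖)) / (r / 2) := by gcongr
          _ ≤ (C / r) / (r / 2) := by
              gcongr
              linarith
          _ = _ := by field_simp
      have hhor : ∀ ε : ℝ, |ε| = 1 →
          ‖Θ ((r : ℂ) + (2 * ε * r : ℝ) * Complex.I) -
            Θ (((c - r : ℝ) : ℂ) + (2 * ε * r : ℝ) * Complex.I)‖ ≤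
            2 * C * r⁻¹ * r⁻¹ * (3 * r) := by
        intro ε hε
        have hmem : ∀ z ∈ segment ℝ (((c - r : ℝ) : ℂ) + (2 * ε * r : ℝ) * Complex.I)
            ((r : ℂ) + (2 * ε * r : ℝ) * Complex.I), z ∈ rightRegion c ∧ r ≤ ‖z‖ ∧
              z - s ∈ Complex.slitPlane := by
          intro z hz
          obtain ⟨him, hre⟩ := mem_segment_horizontal hz
          rw [Set.uIcc_of_le (by linarith)] at hre
          have habs : |z.im| = 2 * r := by
            rw [him, abs_mul, abs_mul, hε, abs_two, abs_of_pos hr0]; ring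
          refine ⟨?_, ?_, ?_⟩
          · change c - |z.im| / 2 ≤ z.re
            rw [habs]
            linarith [hre.1]
          · linarith [Complex.abs_im_le_norm z]
          · rw [Complex.mem_slitPlane_iff]
            right
            rw [Complex.sub_im, sub_ne_zero]
            intro h
            rw [h] at habs
            linarith [Complex.abs_im_le_norm s]
        have h := norm_sub_le_of_norm_deriv_le_segment (F := Θ) (f := fun z => K z / (s - z))
          (fun z hz => hΘ z (rightRegion_subset_slit hc (hmem z hz).1) (hmem z hz).2.2)
          (fun z hz => hbound z (hmem z hz).1 (hmem z hz).2.1)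
        refine h.trans ?_
        gcongr
        rw [add_sub_add_right_eq_sub, ← Complex.ofReal_sub, Complex.norm_real, Real.norm_eq_abs,
          abs_of_pos (by linarith)]
        linarith
      have hver : ‖Θ ((r : ℂ) + (2 * 1 * r : ℝ) * Complex.I) -
            Θ ((r : ℂ) + (2 * (-1) * r : ℝ) * Complex.I)‖ ≤ 2 * C * r⁻¹ * r⁻¹ * (4 * r) := by
        have hmem : ∀ z ∈ segment ℝ ((r : ℂ) + (2 * (-1) * r : ℝ) * Complex.I)
            ((r : ℂ) + (2 * 1 * r : ℝ) * Complex.I), z ∈ rightRegion c ∧ r ≤ ‖z‖ ∧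
              z - s ∈ Complex.slitPlane := by
          intro z hz
          obtain ⟨hre, -⟩ := mem_segment_vertical hz
          refine ⟨?_, ?_, ?_⟩
          · change c - |z.im| / 2 ≤ z.re
            linarith [abs_nonneg z.im]
          · rw [← hre]; exact Complex.re_le_norm z
          · rw [Complex.mem_slitPlane_iff]
            left
            rw [Complex.sub_re]
            linarith
        have h := norm_sub_le_of_norm_deriv_le_segment (F := Θ) (f := fun z => K z / (s - z))
          (fun z hz => hΘ z (rightRegion_subset_slit hc (hmem z hz).1) (hmem z hz).2.2)
          (fun z hz => hbound z (hmem z hz).1 (hmem z hz).2.1)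
        refine h.trans (le_of_eq ?_)
        congr 1
        rw [add_sub_add_left_eq_sub, ← sub_mul, norm_mul, Complex.norm_I, mul_one,
          ← Complex.ofReal_sub, Complex.norm_real, Real.norm_eq_abs, abs_of_pos (by linarith)]
        ring
      have h1 := hhor 1 (by simp)
      have h2 := hhor (-1) (by simp)
      rw [add_mul_dir, add_mul_dir]
      have hsplit : Θ (((c - r : ℝ) : ℂ) + (2 * 1 * r : ℝ) * Complex.I) -
          Θ (((c - r : ℝ) : ℂ) + (2 * (-1) * r : ℝ) * Complex.I) =
          -(Θ ((r : ℂ) + (2 * 1 * r : ℝ) * Complex.I) -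
            Θ (((c - r : ℝ) : ℂ) + (2 * 1 * r : ℝ) * Complex.I)) +
          (Θ ((r : ℂ) + (2 * 1 * r : ℝ) * Complex.I) -
            Θ ((r : ℂ) + (2 * (-1) * r : ℝ) * Complex.I)) +
          (Θ ((r : ℂ) + (2 * (-1) * r : ℝ) * Complex.I) -
            Θ (((c - r : ℝ) : ℂ) + (2 * (-1) * r : ℝ) * Complex.I)) := by ring
      rw [hsplit]
      refine norm_add₃_le.trans ?_
      rw [norm_neg]
      have hfin : 2 * C * r⁻¹ * r⁻¹ * (3 * r) + 2 * C * r⁻¹ * r⁻¹ * (4 * r) +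
          2 * C * r⁻¹ * r⁻¹ * (3 * r) = 20 * C * r⁻¹ := by field_simp; ring
      linarith
    · simpa using tendsto_inv_atTop_zero.const_mul (20 * C)
  have hl := (hray 1 (by simp)).sub (hray (-1) (by simp))
  have hl2 : Tendsto (fun r : ℝ =>
      (fun z => -F z - K s * Complex.log (s - z)) (c + r * dir 1) -
      (fun z => -F z - K s * Complex.log (s - z)) (c + r * dir (-1))) atTop
      (𝓝 (0 + 2 * Real.pi * Complex.I * K s)) := by
    refine (hbig.add_const _).congr' ?_
    filter_upwards [hlog 1 (by simp), hlog (-1) (by simp)] with r h1 h2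
    push_cast at h1 h2
    linear_combination (-K s) * h1 + K s * h2
  have := tendsto_nhds_unique hl hl2
  rw [zero_add] at this
  rw [← this]
  ring

/-! ### The Mellin transform -/

lemma exp_log_div_mul_cpow {ρ x : ℝ} (hρ : 0 < ρ) (hx : 0 < x) (z s : ℂ) :
    Complex.exp (Real.log (ρ / x) * z) * (x : ℂ) ^ (s - 1) =
      (ρ : ℂ) ^ z * (x : ℂ) ^ (s - z - 1) := by
  have hρ' : (ρ : ℂ) ≠ 0 := by exact_mod_cast hρ.ne'
  have hx' : (x : ℂ) ≠ 0 := by exact_mod_cast hx.ne'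
  rw [Real.log_div hρ.ne' hx.ne', Complex.cpow_def_of_ne_zero hx', Complex.cpow_def_of_ne_zero hx',
    Complex.cpow_def_of_ne_zero hρ', ← Complex.exp_add, ← Complex.exp_add, ← Complex.ofReal_log hx.le,
    ← Complex.ofReal_log hρ.le, Complex.ofReal_sub]
  ring_nf

/-- The Mellin transform on `(0, ρ)` of the contribution of one ray of the wedge. -/
lemma mellin_ray {γ c C ε ρ : ℝ} (hρ : 0 < ρ) (hc : γ < c) (hε : |ε| = 1) (hC : 0 ≤ C)
    {K : ℂ → ℂ} (hK : DifferentiableOn ℂ K (slit γ))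
    (hb : ∀ z ∈ rightRegion c, ‖K z‖ ≤ C / (1 + ‖z‖)) {s : ℂ} (hs : c < s.re) :
    IntegrableOn (fun x : ℝ => (∫ r in Set.Ioi (0 : ℝ), K (c + r * dir ε) *
      Complex.exp (Real.log (ρ / x) * (c + r * dir ε))) * (x : ℂ) ^ (s - 1)) (Set.Ioc 0 ρ) ∧
    ∫ x in Set.Ioc 0 ρ, (∫ r in Set.Ioi (0 : ℝ), K (c + r * dir ε) *
      Complex.exp (Real.log (ρ / x) * (c + r * dir ε))) * (x : ℂ) ^ (s - 1) =
      (ρ : ℂ) ^ s * ∫ r in Set.Ioi (0 : ℝ), K (c + r * dir ε) / (s - (c + r * dir ε)) := by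
  set f : ℝ → ℝ → ℂ := fun x r => K (c + r * dir ε) *
      Complex.exp (Real.log (ρ / x) * (c + r * dir ε)) * (x : ℂ) ^ (s - 1) with hf
  have hρ' : (ρ : ℂ) ≠ 0 := by exact_mod_cast hρ.ne'
  have hfx : ∀ x ∈ Set.Ioc 0 ρ, ∀ r, f x r = K (c + r * dir ε) * (ρ : ℂ) ^ (c + r * dir ε) *
      (x : ℂ) ^ (s - (c + r * dir ε) - 1) := by
    intro x hx r
    simp only [hf]
    rw [mul_assoc, mul_assoc, exp_log_div_mul_cpow hρ hx.1]
  have hre : ∀ r : ℝ, (s - (c + r * dir ε)).re = s.re - c + r := fun r => by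
    rw [Complex.sub_re, add_mul_dir_re]; ring
  -- Here `Re (s - z) = Re s - c + r > 0` makes the power of `x` integrable at 0. The integral of
  -- the norm is recorded for Fubini.
  have hinner : ∀ r ∈ Set.Ioi (0 : ℝ), IntegrableOn (fun x => f x r) (Set.Ioc 0 ρ) ∧
      ∫ x in Set.Ioc 0 ρ, f x r = (ρ : ℂ) ^ s * (K (c + r * dir ε) / (s - (c + r * dir ε))) ∧
      ∫ x in Set.Ioc 0 ρ, ‖f x r‖ = ρ ^ s.re * (‖K (c + r * dir ε)‖ / (s.re - c + r)) := by
    intro r hr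
    have hr' : 0 < r := hr
    have hpos : 0 < s.re - c + r := by linarith
    have hexp : -1 < (s - (c + r * dir ε) - 1).re := by
      rw [Complex.sub_re, hre, Complex.one_re]; linarith
    refine ⟨?_, ?_, ?_⟩
    · have h1 := (intervalIntegral.intervalIntegrable_cpow' (a := 0) (b := ρ) hexp).const_mul
        (K (c + r * dir ε) * (ρ : ℂ) ^ (c + r * dir ε))
      rw [intervalIntegrable_iff_integrableOn_Ioc_of_le hρ.le] at h1
      exact h1.congr_fun (fun x hx => (hfx x hx r).symm) measurableSet_Ioc
    · rw [setIntegral_congr_fun measurableSet_Ioc (fun x hx => hfx x hx r),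
        integral_const_mul, ← intervalIntegral.integral_of_le hρ.le,
        integral_cpow (Or.inl hexp)]
      have hne : s - (c + r * dir ε) ≠ 0 := fun h => by
        have := hre r
        rw [h, Complex.zero_re] at this
        linarith
      rw [sub_add_cancel, Complex.ofReal_zero, Complex.zero_cpow hne, sub_zero,
        Complex.cpow_sub _ _ hρ']
      have : (ρ : ℂ) ^ (c + r * dir ε) ≠ 0 := by
        rw [Ne, Complex.cpow_eq_zero_iff]; exact fun h => hρ' h.1
      field_simp
    · have hn : ∀ x ∈ Set.Ioc 0 ρ, ‖f x r‖ = ‖K (c + r * dir ε)‖ * ρ ^ (c - r) *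
          x ^ (s.re - c + r - 1) := by
        intro x hx
        rw [hfx x hx r, norm_mul, norm_mul, Complex.norm_cpow_eq_rpow_re_of_pos hρ,
          Complex.norm_cpow_eq_rpow_re_of_pos hx.1, add_mul_dir_re, Complex.sub_re, hre,
          Complex.one_re]
      rw [setIntegral_congr_fun measurableSet_Ioc hn, integral_const_mul,
        ← intervalIntegral.integral_of_le hρ.le, integral_rpow (Or.inl (by linarith)),
        sub_add_cancel, Real.zero_rpow hpos.ne', sub_zero]
      have h2 : ρ ^ s.re = ρ ^ (c - r) * ρ ^ (s.re - c + r) := by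
        rw [← Real.rpow_add hρ]; ring_nf
      rw [h2]
      ring
  have hcontK : ContinuousOn (fun r : ℝ => K (c + r * dir ε)) (Set.Ioi 0) :=
    hK.continuousOn.comp (by fun_prop) fun r hr =>
      rightRegion_subset_slit hc (add_mul_dir_mem_rightRegion hε (le_of_lt hr))
  have hmeas : AEStronglyMeasurable (Function.uncurry f)
      ((volume.restrict (Set.Ioc 0 ρ)).prod (volume.restrict (Set.Ioi (0 : ℝ)))) := by
    rw [Measure.prod_restrict]
    refine ContinuousOn.aestronglyMeasurable ?_ (measurableSet_Ioc.prod measurableSet_Ioi)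
    have hlog : ContinuousOn (fun y : ℝ × ℝ => Real.log (ρ / y.1))
        (Set.Ioc 0 ρ ×ˢ Set.Ioi (0 : ℝ)) := by
      refine ContinuousOn.log (continuousOn_const.div continuousOn_fst fun y hy => hy.1.1.ne')
        fun y hy => (div_pos hρ hy.1.1).ne'
    have hK2 : ContinuousOn (fun y : ℝ × ℝ => K (c + y.2 * dir ε))
        (Set.Ioc 0 ρ ×ˢ Set.Ioi (0 : ℝ)) :=
      hcontK.comp continuousOn_snd fun y hy => hy.2
    have hpow : ContinuousOn (fun y : ℝ × ℝ => (y.1 : ℂ) ^ (s - 1))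
        (Set.Ioc 0 ρ ×ˢ Set.Ioi (0 : ℝ)) := by
      refine ContinuousOn.cpow_const (by fun_prop) fun y hy => ?_
      exact Complex.ofReal_mem_slitPlane.2 hy.1.1
    exact (hK2.mul (((Complex.continuous_ofReal.comp_continuousOn hlog).mul
      (by fun_prop)).cexp)).mul hpow
  have hint : Integrable (Function.uncurry f)
      ((volume.restrict (Set.Ioc 0 ρ)).prod (volume.restrict (Set.Ioi (0 : ℝ)))) := by
    rw [integrable_prod_iff' hmeas]
    constructor
    · exact (ae_restrict_iff' measurableSet_Ioi).2 (Eventually.of_forall fun r hr =>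
        (hinner r hr).1)
    · have h1 : IntegrableOn (fun r : ℝ => ρ ^ s.re * (‖K (c + r * dir ε)‖ / (s.re - c + r)))
          (Set.Ioi 0) := by
        refine Integrable.const_mul ?_ _
        refine Integrable.mono' ((integrable_inv_one_add_sq.const_mul
          (C / min (s.re - c) 1)).restrict)
          (ContinuousOn.aestronglyMeasurable ?_ measurableSet_Ioi) ?_
        · refine hcontK.norm.div (by fun_prop) fun r hr => ?_
          have hr' : 0 < r := hr
          linarith
        · refine (ae_restrict_iff' measurableSet_Ioi).2 (Eventually.of_forall fun r hr => ?_)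
          have hr' : 0 < r := hr
          refine le_trans ?_ (ray_weight_le hC hε hr'.le hs)
          have h1 := hb _ (add_mul_dir_mem_rightRegion (c := c) hε hr'.le)
          have h3 : 0 < s.re - c + r := by linarith
          rw [norm_div, norm_norm, Real.norm_eq_abs, abs_of_pos h3]
          gcongr
      exact h1.congr_fun (fun r hr => ((hinner r hr).2.2).symm) measurableSet_Ioi
  have hprod : ∀ x : ℝ, (∫ r in Set.Ioi (0 : ℝ), K (c + r * dir ε) *
      Complex.exp (Real.log (ρ / x) * (c + r * dir ε))) * (x : ℂ) ^ (s - 1) =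
      ∫ r in Set.Ioi (0 : ℝ), f x r := fun x => (integral_mul_const _ _).symm
  simp_rw [hprod]
  refine ⟨hint.integral_prod_left, ?_⟩
  rw [integral_integral_swap hint, ← integral_const_mul]
  exact setIntegral_congr_fun measurableSet_Ioi fun r hr => (hinner r hr).2.1

/-- `x^(-z) = ρ^(-z) (ρ/x)^z`; the sign of `log(ρ/x)` decides on which side the integrand decays. -/
lemma gammaRatio_mul_cpow_neg {A a : Fin p → ℝ} {B b : Fin q → ℝ} (hA : ∀ k, 0 < A k)
    (hB : ∀ j, 0 < B j) (m : ℕ) {x : ℝ} (hx : 0 < x) (z : ℂ) :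
    gammaRatio A a B b z * (x : ℂ) ^ (-z) =
      (remainder A a B b m z + principalPart A a B b m z) *
        Complex.exp (Real.log (rho A B / x) * z) := by
  have hρ := rho_pos hA hB
  have hρ' : (rho A B : ℂ) ≠ 0 := by exact_mod_cast hρ.ne'
  have hx' : (x : ℂ) ≠ 0 := by exact_mod_cast hx.ne'
  rw [remainder, sub_add_cancel, mul_assoc, Real.log_div hρ.ne' hx.ne',
    Complex.cpow_def_of_ne_zero hx', Complex.cpow_def_of_ne_zero hρ', ← Complex.exp_add,
    ← Complex.ofReal_log hx.le, ← Complex.ofReal_log hρ.le, Complex.ofReal_sub]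
  ring_nf

lemma H_eq_zero {A a : Fin p → ℝ} {B b : Fin q → ℝ} (hA : ∀ k, 0 < A k) (hB : ∀ j, 0 < B j)
    (hΔ : Delta A B = 0) {m : ℕ} (hμ : mu a b = -(m : ℝ)) {c φ₁ φ₂ : ℝ} (hc : gam A a < c)
    (hφ₁ : φ₁ < 0) (hφ₂ : 0 < φ₂) {x : ℝ} (hx : rho A B < x) :
    H A a B b c φ₁ φ₂ x = 0 := by
  have hρ := rho_pos hA hB
  have hx0 : 0 < x := hρ.trans hx
  obtain ⟨C, hC, hK⟩ := exists_norm_remainder_le hA hB hΔ hμ hc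
  obtain ⟨C₂, hC₂, hP⟩ := exists_norm_principalPart_le A a B b m
  rw [H, if_neg hx.not_gt]
  simp_rw [gammaRatio_mul_cpow_neg hA hB m hx0]
  have hκ : 0 < -Real.log (rho A B / x) :=
    neg_pos.2 (Real.log_neg (div_pos hρ hx0) ((div_lt_one hx0).2 hx))
  have h := rightLoopIntegral_eq_zero (C := C + C₂) (n := m) hc hφ₁ hφ₂ hκ (by positivity)
    (g := fun z => remainder A a B b m z + principalPart A a B b m z)
    ((differentiableOn_remainder b hA hB m).add
      (differentiable_principalPart A a B b m).differentiableOn) (fun z hz => by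
      have h1 := hK z (by
        change c - |z.im| / 2 ≤ z.re
        linarith [abs_nonneg z.im])
      have h2 : C / (1 + ‖z‖) ≤ C * (1 + ‖z‖) ^ m := by
        have h3 : 1 ≤ 1 + ‖z‖ := by linarith [norm_nonneg z]
        exact (div_le_self hC h3).trans (le_mul_of_one_le_right hC (one_le_pow₀ h3))
      refine (norm_add_le _ _).trans ?_
      rw [add_mul]
      linarith [hP z])
  rw [neg_neg] at h
  rw [h, mul_zero]

lemma H_eq_wedge {A a : Fin p → ℝ} {B b : Fin q → ℝ} (hA : ∀ k, 0 < A k) (hB : ∀ j, 0 < B j)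
    (hΔ : Delta A B = 0) {m : ℕ} (hμ : mu a b = -(m : ℝ)) {c φ₁ φ₂ : ℝ} (hc : gam A a < c)
    (hφ₁ : φ₁ < 0) (hφ₂ : 0 < φ₂) {c' : ℝ} (hc' : gam A a < c')
    {x : ℝ} (hx0 : 0 < x) (hx : x < rho A B) :
    H A a B b c φ₁ φ₂ x = 1 / (2 * Real.pi * Complex.I) *
      ((∫ r in Set.Ioi (0 : ℝ), remainder A a B b m (c' + r * dir 1) *
        Complex.exp (Real.log (rho A B / x) * (c' + r * dir 1))) * dir 1 -
      (∫ r in Set.Ioi (0 : ℝ), remainder A a B b m (c' + r * dir (-1)) *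
        Complex.exp (Real.log (rho A B / x) * (c' + r * dir (-1)))) * dir (-1)) := by
  have hρ := rho_pos hA hB
  obtain ⟨C, hC, hK⟩ := exists_norm_remainder_le hA hB hΔ hμ hc'
  obtain ⟨C₂, hC₂, hP⟩ := exists_norm_principalPart_le A a B b m
  obtain ⟨C₃, hC₃, hG⟩ := exists_norm_gammaRatio_le_left hA hB hΔ hμ c
    (φ := min (-φ₁) φ₂) (lt_min (by linarith) hφ₂)
  rw [H, if_pos hx]
  simp_rw [gammaRatio_mul_cpow_neg hA hB m hx0]
  have hκ : 0 < Real.log (rho A B / x) := Real.log_pos ((one_lt_div hx0).2 hx)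
  have hle : ∀ {D : ℝ} (z : ℂ), D ≤ C + C₂ + C₃ →
      D * (1 + ‖z‖) ^ m ≤ (C + C₂ + C₃) * (1 + ‖z‖) ^ m := fun z h => by gcongr
  rw [leftLoopIntegral_eq_wedge (C := C + C₂ + C₃) (n := m) hc hc' hφ₁ hφ₂ hκ (by positivity)
    (differentiableOn_remainder b hA hB m) (differentiable_principalPart A a B b m)
    (fun z hz => (hK z hz).trans ((div_le_self hC (by linarith [norm_nonneg z])).trans
      (by linarith)))
    (fun z => (hP z).trans (hle z (by linarith)))
    (fun z h1 h2 => by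
      rw [remainder, sub_add_cancel]
      exact (hG z h1 h2).trans (hle z (by linarith)))]

lemma mellin_H_Ioc {A a : Fin p → ℝ} {B b : Fin q → ℝ} (hA : ∀ k, 0 < A k) (hB : ∀ j, 0 < B j)
    (hΔ : Delta A B = 0) {m : ℕ} (hμ : mu a b = -(m : ℝ)) {c φ₁ φ₂ : ℝ} (hc : gam A a < c)
    (hφ₁ : φ₁ < 0) (hφ₂ : 0 < φ₂) {s : ℂ} (hs : gam A a < s.re) :
    IntegrableOn (fun x : ℝ => H A a B b c φ₁ φ₂ x * (x : ℂ) ^ (s - 1)) (Set.Ioc 0 (rho A B)) ∧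
    ∫ x in Set.Ioc 0 (rho A B), H A a B b c φ₁ φ₂ x * (x : ℂ) ^ (s - 1) =
      (rho A B : ℂ) ^ s * remainder A a B b m s := by
  have hρ := rho_pos hA hB
  -- The vertex of the wedge is unrelated to the abscissa `c` of the loop, so it can be placed left
  -- of `Re s`.
  obtain ⟨c', hc', hc's⟩ := exists_between hs
  obtain ⟨C, hC, hK⟩ := exists_norm_remainder_le hA hB hΔ hμ hc'
  have hd := differentiableOn_remainder b hA hB m (a := a)
  obtain ⟨i₁, e₁⟩ := mellin_ray hρ hc' (ε := 1) (by simp) hC hd hK hc's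
  obtain ⟨i₂, e₂⟩ := mellin_ray hρ hc' (ε := -1) (by simp) hC hd hK hc's
  have hcauchy := wedge_integral_eq hc' hC hd hK hc's
  have i := ((i₁.mul_const (dir 1)).sub (i₂.mul_const (dir (-1)))).const_mul
    (1 / (2 * Real.pi * Complex.I))
  have hae : (fun x : ℝ => H A a B b c φ₁ φ₂ x * (x : ℂ) ^ (s - 1)) =ᵐ[volume.restrict
      (Set.Ioc 0 (rho A B))] fun x => 1 / (2 * Real.pi * Complex.I) *
      ((∫ r in Set.Ioi (0 : ℝ), remainder A a B b m (c' + r * dir 1) *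
        Complex.exp (Real.log (rho A B / x) * (c' + r * dir 1))) * (x : ℂ) ^ (s - 1) * dir 1 -
      (∫ r in Set.Ioi (0 : ℝ), remainder A a B b m (c' + r * dir (-1)) *
        Complex.exp (Real.log (rho A B / x) * (c' + r * dir (-1)))) * (x : ℂ) ^ (s - 1) *
        dir (-1)) := by
    -- The wedge formula needs `x < ρ`; the endpoint is a null set.
    rw [← Measure.restrict_congr_set (Ioo_ae_eq_Ioc (α := ℝ) (μ := volume))]
    filter_upwards [self_mem_ae_restrict measurableSet_Ioo] with x hx
    rw [H_eq_wedge hA hB hΔ hμ hc hφ₁ hφ₂ hc' hx.1 hx.2]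
    ring
  refine ⟨i.congr hae.symm, ?_⟩
  rw [integral_congr_ae hae, integral_const_mul, integral_sub (i₁.mul_const _) (i₂.mul_const _),
    integral_mul_const, integral_mul_const, e₁, e₂]
  have hpi : (2 * Real.pi * Complex.I : ℂ) ≠ 0 := Complex.two_pi_I_ne_zero
  rw [one_div, inv_mul_eq_iff_eq_mul₀ hpi]
  linear_combination ((rho A B : ℂ) ^ s) * hcauchy

end FoxH

end

theorem theorem2 {p q : ℕ} (hp : 0 < p)
    (A a : Fin p → ℝ) (B b : Fin q → ℝ)
    (hA : ∀ k, 0 < A k) (hB : ∀ j, 0 < B j)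
    (hΔ : FoxH.Delta A B = 0)
    (m : ℕ) (hμ : FoxH.mu a b = -(m : ℝ))
    (c φ₁ φ₂ : ℝ) (hc : FoxH.gam A a < c) (hφ₁ : φ₁ < 0) (hφ₂ : 0 < φ₂)
    (s : ℂ) (hs : FoxH.gam A a < s.re) :
    MellinConvergent (FoxH.H A a B b c φ₁ φ₂) s ∧
    mellin (FoxH.H A a B b c φ₁ φ₂) s =
      (∫ x in (0 : ℝ)..FoxH.rho A B, FoxH.H A a B b c φ₁ φ₂ x * (x : ℂ) ^ (s - 1)) ∧
    (∫ x in (0 : ℝ)..FoxH.rho A B, FoxH.H A a B b c φ₁ φ₂ x * (x : ℂ) ^ (s - 1)) =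
      FoxH.gammaRatio A a B b s -
        (FoxH.nu A a B b : ℂ) * (FoxH.rho A B : ℂ) ^ s *
          ∑ k ∈ Finset.range (m + 1), (FoxH.lCoeff A a B b (m - k) : ℂ) * s ^ k := by
  have hρ := FoxH.rho_pos hA hB
  obtain ⟨hi, he⟩ := FoxH.mellin_H_Ioc hA hB hΔ hμ hc hφ₁ hφ₂ hs
  have hzero : Set.EqOn (fun _ => (0 : ℂ)) (fun x : ℝ => FoxH.H A a B b c φ₁ φ₂ x *
      (x : ℂ) ^ (s - 1)) (Set.Ioi (FoxH.rho A B)) := fun x hx => by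
    simp only [FoxH.H_eq_zero hA hB hΔ hμ hc hφ₁ hφ₂ hx, zero_mul]
  have hi' : MeasureTheory.IntegrableOn (fun x : ℝ => FoxH.H A a B b c φ₁ φ₂ x *
      (x : ℂ) ^ (s - 1)) (Set.Ioi (FoxH.rho A B)) :=
    MeasureTheory.integrableOn_zero.congr_fun hzero measurableSet_Ioi
  have hcomm : (fun x : ℝ => (x : ℂ) ^ (s - 1) • FoxH.H A a B b c φ₁ φ₂ x) =
      fun x : ℝ => FoxH.H A a B b c φ₁ φ₂ x * (x : ℂ) ^ (s - 1) := by
    ext x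
    rw [smul_eq_mul, mul_comm]
  have hunion : Set.Ioi (0 : ℝ) = Set.Ioc 0 (FoxH.rho A B) ∪ Set.Ioi (FoxH.rho A B) :=
    (Set.Ioc_union_Ioi_eq_Ioi hρ.le).symm
  rw [intervalIntegral.integral_of_le hρ.le]
  refine ⟨?_, ?_, ?_⟩
  · rw [MellinConvergent, hcomm, hunion]
    exact hi.union hi'
  · rw [mellin, hcomm, hunion, MeasureTheory.setIntegral_union (Set.Ioc_disjoint_Ioi le_rfl)
      measurableSet_Ioi hi hi', ← MeasureTheory.setIntegral_congr_fun measurableSet_Ioi hzero]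
    simp
  · have hρ' : (FoxH.rho A B : ℂ) ≠ 0 := by exact_mod_cast hρ.ne'
    have hcancel : (FoxH.rho A B : ℂ) ^ s * (FoxH.rho A B : ℂ) ^ (-s) = 1 := by
      rw [← Complex.cpow_add _ _ hρ', add_neg_cancel, Complex.cpow_zero]
    rw [he, FoxH.remainder, FoxH.principalPart]
    linear_combination (FoxH.gammaRatio A a B b s) * hcancel
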